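/- Let $d\ge 1$, $\mathscr X=(0,1)^d$, and let $k(x,x')=\prod_{j=1}^d[\theta_j+\gamma_j\min(x_j,x'_j)]$ with constants $\theta_j,\gamma_j>0$ (a Brownian field kernel). For $\tau\ge1$ let $$\mathcal X_\tau=\bigcup_{l\in\{1,2,\dots\}^d,\ l_1+\dots+l_d\le\tau+d-1}\ \prod_{j=1}^d\{i\,2^{-l_j}:1\le i\le 2^{l_j}-1\}$$ be the classical sparse grid of level $\tau$, and put $N_\tau=|\mathcal X_\tau|$. *The algorithm KEIBS (noise-free samples, $\lambda=0$, $\delta_n=1$).* For points $x_1,\dots,x_n$ write $K_n=(k(x_i,x_j))_{i,j\le n}$ and $k_n(x)=(k(x_1,x),\dots,k(x_n,x))^{\top}$. Given a function $f$ on $\mathscr X$ and a budget $N\ge1$, let $\tau\ge 1$ be the level with $N_\tau\le N<N_{\tau+1}$. Stage 1: let $\{x_1,\dots,x_{N_\tau}\}=\mathcal X_\tau$, in any order, and $$\breve f_{N_\tau}(x)=k_{N_\tau}(x)^{\top}K_{N_\tau}^{-1}\,(f(x_i))_{i\le N_\tau}.$$ For $n\ge N_\tau$ put $$\tilde f_n(x)=\breve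 f_{N_\tau}(x)+k_n(x)^{\top}K_n^{-1}\bigl(f(x_i)-\breve f_{N_\tau}(x_i)\bigr)_{i\le n},\qquad s_n^2(x)=k(x,x)-k_n(x)^{\top}K_n^{-1}k_n(x).$$ Stage 2: for $n=N_\tau,\dots,N-1$ let $x_{n+1}$ be any maximizer over $x\in\mathcal X_{\tau+1}$ of the expected improvement $$s_n(x)\,\eta\Bigl(\bigl(\tilde f_n(x)-\max_{i\le n}\tilde f_n(x_i)\bigr)/s_n(x)\Bigr),\qquad \eta(t)=t\,\Phi(t)+\varphi(t),$$ where $\Phi,\varphi$ are the standard normal distribution function and density, and the expected improvement is $0$ where $s_n(x)=0$. The output $\hat x^*_N$ is a maximizer of $\tilde f_N$ over $\mathscr X$. *Theorem.* Let $f\in\mathscr H^1_{\mathsf{mix}}$, that is, $f\in L^2(\mathscr X)$ and all weak partial derivatives $D^\alpha f$ with $\alpha\in\{0,1\}^d$ exist and lie in $L^2(\mathscr X)$; as usual, $f$ stands for the continuous representative of its class. Suppose that $f$ has a global maximum at $x^*\in\mathscr X$. Then there is a constant $C$ such that for every $N\ge2$ and every run of KEIBS with budget $N$, $$f(x^*)-f(\hat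 x^*_N)\ \le\ C\,N^{-1/2}(\log N)^{3(d-1)/2}$$ for every maximizer $\hat x^*_N\in\mathscr X$ of $\tilde f_N$ over $\mathscr X$. More generally, since $\tilde f_N$ need not attain its supremum on the open cube: for every $\varepsilon\ge0$ and every $\hat x\in\mathscr X$ with $\tilde f_N(z)\le\tilde f_N(\hat x)+\varepsilon$ for all $z\in\mathscr X$, one has $f(x^*)-f(\hat x)\le C\,N^{-1/2}(\log N)^{3(d-1)/2}+\varepsilon$. -/

import Mathlib

open MeasureTheory ProbabilityTheory
open scoped Matrix ContDiff

noncomputable section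

/-- The open unit cube `(0,1)^d`, the feasible set. -/
def unitCube (d : ℕ) : Set (Fin d → ℝ) := {x | ∀ j, 0 < x j ∧ x j < 1}

/-! ### Sobolev spaces with dominating mixed smoothness -/

/-- The classical partial derivative `∂φ/∂x_j`. -/
def partialDeriv {d : ℕ} (j : Fin d) (φ : (Fin d → ℝ) → ℝ) (x : Fin d → ℝ) : ℝ :=
  fderiv ℝ φ x (Pi.single j 1)

/-- The classical mixed partial derivative `∏_{j ∈ S} ∂/∂x_j` of order `|S|` (once in each
direction of `S`) of a function `φ`; it is only used for smooth `φ`, where the order of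
differentiation is immaterial. -/
def mixedPartial {d : ℕ} (S : Finset (Fin d)) (φ : (Fin d → ℝ) → ℝ) : (Fin d → ℝ) → ℝ :=
  (S.sort (· ≤ ·)).foldr partialDeriv φ

/-- `g` is the weak mixed partial derivative `∏_{j ∈ S} ∂/∂x_j f` on the open unit cube:
`∫ f ∂^S φ = (-1)^{|S|} ∫ g φ` for all smooth `φ` with compact support in the cube. -/
def IsWeakMixedPartial {d : ℕ} (S : Finset (Fin d)) (f g : (Fin d → ℝ) → ℝ) : Prop :=
  ∀ φ : (Fin d → ℝ) → ℝ, ContDiff ℝ ∞ φ → HasCompactSupport φ → tsupport φ ⊆ unitCube d →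
    ∫ x in unitCube d, f x * mixedPartial S φ x =
      (-1) ^ S.card * ∫ x in unitCube d, g x * φ x

/-- The order-one Sobolev space with dominating mixed smoothness on `(0,1)^d`: functions in `L²`
all of whose weak derivatives `D^α f` with `α ∈ {0,1}^d` are in `L²`.  The multi-index `α` is
encoded as the set `S` of the coordinates `j` with `α_j = 1`. -/
def MemHMixOne {d : ℕ} (f : (Fin d → ℝ) → ℝ) : Prop :=
  MemLp f 2 (volume.restrict (unitCube d)) ∧
    ∀ S : Finset (Fin d), ∃ g : (Fin d → ℝ) → ℝ,
      MemLp g 2 (volume.restrict (unitCube d)) ∧ IsWeakMixedPartial S f g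

/-! ### Brownian field kernels -/

/-- The Brownian field kernel `∏_j (θ_j + γ_j min(x_j, x'_j))`. -/
def bfKernel {d : ℕ} (θ γ : Fin d → ℝ) (x x' : Fin d → ℝ) : ℝ :=
  ∏ j, (θ j + γ j * min (x j) (x' j))

/-! ### Classical sparse grids -/

/-- The one-dimensional dyadic grid `{i 2^{-l} : i = 1, …, 2^l - 1}`. -/
def dyadicGrid (l : ℕ) : Finset ℝ :=
  (Finset.Icc 1 (2 ^ l - 1)).image fun i : ℕ => (i : ℝ) / 2 ^ l

/-- The classical sparse grid of level `τ ≥ 1` in dimension `d ≥ 1`: the union of the full grids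
`∏_j dyadicGrid (l_j)` over all `l` with `l_j ≥ 1` and `l_1 + ⋯ + l_d ≤ τ + d - 1`.
(These constraints force `l_j ≤ τ`, so that `l` ranges over a finite set.) -/
def sparseGrid (d τ : ℕ) : Finset (Fin d → ℝ) :=
  ((Fintype.piFinset fun _ : Fin d => Finset.Icc 1 τ).filter
      fun l => ∑ j, l j ≤ τ + d - 1).biUnion
    fun l => Fintype.piFinset fun j => dyadicGrid (l j)

/-! ### The algorithm

Design points and observations are sequences indexed from `0`, so that `x 0, …, x (n - 1)` are the
first `n` design points and `y i` is the observation taken at `x i`. -/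

/-- The kernel matrix of the first `n` design points. -/
def kernelMatrix {d : ℕ} (θ γ : Fin d → ℝ) (x : ℕ → Fin d → ℝ) (n : ℕ) :
    Matrix (Fin n) (Fin n) ℝ :=
  Matrix.of fun i j => bfKernel θ γ (x i) (x j)

/-- The vector of the values `k(x_i, z)` over the first `n` design points. -/
def kernelVec {d : ℕ} (θ γ : Fin d → ℝ) (x : ℕ → Fin d → ℝ) (n : ℕ) (z : Fin d → ℝ) :
    Fin n → ℝ :=
  fun i => bfKernel θ γ (x i) z

/-- The kernel ridge regression estimate from the first `n` observations,
`k_n(z)ᵀ (K_n + n λ I)⁻¹ y_n`. -/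
def krr {d : ℕ} (θ γ : Fin d → ℝ) (lam : ℝ) (x : ℕ → Fin d → ℝ) (y : ℕ → ℝ) (n : ℕ)
    (z : Fin d → ℝ) : ℝ :=
  kernelVec θ γ x n z ⬝ᵥ
    ((kernelMatrix θ γ x n + ((n : ℝ) * lam) • (1 : Matrix (Fin n) (Fin n) ℝ))⁻¹ *ᵥ
      fun i : Fin n => y i)

/-- The Stage 2 surrogate mean after `n` samples, `n₀` of which were taken in Stage 1:
`f̂(z) + δ_n² k_n(z)ᵀ (δ_n² K_n + σ² I)⁻¹ (y_n - f̂_n)`, with `f̂` the Stage 1 estimate. -/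
def surrogateMean {d : ℕ} (θ γ : Fin d → ℝ) (σ lam : ℝ) (δ : ℕ → ℝ) (n₀ : ℕ)
    (x : ℕ → Fin d → ℝ) (y : ℕ → ℝ) (n : ℕ) (z : Fin d → ℝ) : ℝ :=
  krr θ γ lam x y n₀ z +
    δ n ^ 2 * (kernelVec θ γ x n z ⬝ᵥ
      ((δ n ^ 2 • kernelMatrix θ γ x n + σ ^ 2 • (1 : Matrix (Fin n) (Fin n) ℝ))⁻¹ *ᵥ
        fun i : Fin n => y i - krr θ γ lam x y n₀ (x i)))

/-- The Stage 2 surrogate variance `s_n²(z)` after `n` samples: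
`δ_n² k(z,z) - δ_n² k_n(z)ᵀ (δ_n² K_n + σ² I)⁻¹ (δ_n² k_n(z))`. -/
def surrogateVar {d : ℕ} (θ γ : Fin d → ℝ) (σ : ℝ) (δ : ℕ → ℝ)
    (x : ℕ → Fin d → ℝ) (n : ℕ) (z : Fin d → ℝ) : ℝ :=
  δ n ^ 2 * bfKernel θ γ z z -
    δ n ^ 2 * (kernelVec θ γ x n z ⬝ᵥ
      ((δ n ^ 2 • kernelMatrix θ γ x n + σ ^ 2 • (1 : Matrix (Fin n) (Fin n) ℝ))⁻¹ *ᵥ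
        (δ n ^ 2 • kernelVec θ γ x n z)))

/-- The information value function `η(t) = t Φ(t) + φ(t)`, with `Φ` and `φ` the distribution
function and the density of the standard normal distribution. -/
def infoValue (t : ℝ) : ℝ := t * cdf (gaussianReal 0 1) t + gaussianPDFReal 0 1 t

/-- The expected improvement acquisition function
`s_n(z) η((f̃_n(z) - max_{i ≤ n} f̃_n(x_i)) / s_n(z))`.  Where `s_n(z) = 0` its value is `0`; for
noise-free samples this happens only at points already sampled, where `0` is also the limit of the
expression as `s_n(z)` tends to `0`. -/
def expectedImprovement {d : ℕ} (θ γ : Fin d → ℝ) (σ lam : ℝ) (δ : ℕ → ℝ) (n₀ : ℕ)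
    (x : ℕ → Fin d → ℝ) (y : ℕ → ℝ) (n : ℕ) (z : Fin d → ℝ) : ℝ :=
  √(surrogateVar θ γ σ δ x n z) *
    infoValue
      ((surrogateMean θ γ σ lam δ n₀ x y n z -
          ⨆ i : Fin n, surrogateMean θ γ σ lam δ n₀ x y n (x i)) /
        √(surrogateVar θ γ σ δ x n z))

/-- `x 0, …, x (N - 1)` are the design points of a run of the algorithm with budget `N`, in which
`y i` was observed at `x i` and sparse grid level `τ` was selected in Stage 1.  Ties in the
selection of a design point may be broken in any way. -/
structure IsKEIBSRun {d : ℕ} (θ γ : Fin d → ℝ) (σ lam : ℝ) (δ : ℕ → ℝ) (N τ : ℕ)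
    (x : ℕ → Fin d → ℝ) (y : ℕ → ℝ) : Prop where
  one_le_level : 1 ≤ τ
  card_le : (sparseGrid d τ).card ≤ N
  lt_card : N < (sparseGrid d (τ + 1)).card
  /-- Stage 1: the first `|sparseGrid d τ|` design points enumerate the sparse grid. -/
  stage_one : (Finset.range (sparseGrid d τ).card).image x = sparseGrid d τ
  /-- Stage 2: each further design point lies in the sparse grid of level `τ + 1` and maximizes
  the acquisition function over it. -/
  stage_two : ∀ n, (sparseGrid d τ).card ≤ n → n < N →
    x n ∈ sparseGrid d (τ + 1) ∧
      IsMaxOn (expectedImprovement θ γ σ lam δ (sparseGrid d τ).card x y n)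
        (sparseGrid d (τ + 1)) (x n)

end

/-!
For `μ` the product of the measures `θ_j δ₀ + γ_j dt` on `[0,1)`, the Brownian field kernel
`k(x, x')` is the inner product in `L²(μ)` of the indicators of the lower sets of `x` and `x'`.
For a function of the form `f z = L 1_{· ≤ z}` with `L` a continuous functional on `L²(μ)`, the
noise-free surrogate is `L` applied to the orthogonal projection of `1_{· ≤ z}` onto the span of the
indicators of the design points, so that its error at `z` is at most `‖L‖` times the distance from
`1_{· ≤ z}` to that span. Expanding `1_{· ≤ z}` in each coordinate into the increments of its dyadic
approximations, and keeping the products of increments of total level below `τ`, shows that this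
distance is `O(2^{-τ/2} τ^{d-1})`. Since `N` is less than the number `O(2^τ τ^{d-1})` of points of
the next sparse grid, the error is of the asserted order; a near-maximizer of the surrogate is
suboptimal for `f` by at most twice the error.

That `f ∈ H¹_mix` has this form follows by testing its weak derivatives against products of
primitives of differences `ρ_j - w`, where `w` is a fixed bump function and `ρ_j` concentrates at
`x_j` from the right. In the limit these primitives become `1 - 1_{· ≤ x_j} - ∫ w`, and `f x` is a
sum of integrals of the derivatives against products of such functions. These integrals are
continuous in `1_{· ≤ x}`, because Lebesgue measure on each face of the cube through the origin is
dominated by a multiple of `μ`.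

The acquisition function matters only because the expected improvement vanishes exactly at the
points already sampled: Stage 2 never repeats a point, and the kernel matrix stays invertible.
-/

open Topology Filter
open scoped RealInnerProductSpace

section LowerIndicator

variable {α : Type*} [TopologicalSpace α] [PartialOrder α] [OrderClosedTopology α]
  [MeasurableSpace α] [OpensMeasurableSpace α]

/-- The indicator function of `Set.Iic x` as an element of `L²(μ)`. -/
noncomputable def lowerIndicator (μ : Measure α) [IsFiniteMeasure μ] (x : α) : Lp ℝ 2 μ :=
  indicatorConstLp 2 measurableSet_Iic (measure_ne_top μ (Set.Iic x)) 1

variable (μ : Measure α) [IsFiniteMeasure μ]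

lemma coeFn_lowerIndicator (x : α) :
    lowerIndicator μ x =ᵐ[μ] (Set.Iic x).indicator fun _ => 1 :=
  indicatorConstLp_coeFn

lemma inner_lowerIndicator (x y : α) :
    ⟪lowerIndicator μ x, lowerIndicator μ y⟫ = μ.real (Set.Iic x ∩ Set.Iic y) :=
  L2.real_inner_indicatorConstLp_one_indicatorConstLp_one measurableSet_Iic measurableSet_Iic

lemma linearIndependent_lowerIndicator {ι : Type*} {v : ι → α} (hv : Function.Injective v)
    (hμ : ∀ i, ∀ U ∈ 𝓝 (v i), μ (U ∩ Set.Iic (v i)) ≠ 0) :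
    LinearIndependent ℝ fun i => lowerIndicator μ (v i) := by
  classical
  refine linearIndependent_iff'.2 fun s a hsum => ?_
  by_contra! hne
  obtain ⟨i, hi, hmax⟩ := (s.filter (a · ≠ 0)).exists_maximalFor v
    (hne.imp fun _ h => Finset.mem_filter.2 h)
  obtain ⟨his, hai⟩ := Finset.mem_filter.1 hi
  set U : Set α := ⋂ j ∈ (s.filter (a · ≠ 0)).erase i, (Set.Iic (v j))ᶜ
  have hUmeas : MeasurableSet (U ∩ Set.Iic (v i)) :=
    (Finset.measurableSet_biInter _ fun _ _ => measurableSet_Iic.compl).inter measurableSet_Iic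
  have hUmem : U ∈ 𝓝 (v i) := by
    refine (biInter_finset_mem _).2 fun j hj => isClosed_Iic.isOpen_compl.mem_nhds fun hle => ?_
    obtain ⟨hji, hj⟩ := Finset.mem_erase.1 hj
    exact hji (hv ((hmax hj hle).antisymm hle))
  have hinner (j : ι) :
      ⟪indicatorConstLp 2 hUmeas (measure_ne_top μ _) (1 : ℝ), lowerIndicator μ (v j)⟫ =
        μ.real (U ∩ Set.Iic (v i) ∩ Set.Iic (v j)) :=
    L2.real_inner_indicatorConstLp_one_indicatorConstLp_one hUmeas measurableSet_Iic
  have hzero : ∑ j ∈ s, a j * μ.real (U ∩ Set.Iic (v i) ∩ Set.Iic (v j)) = 0 := by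
    simp only [← hinner, ← real_inner_smul_right, ← inner_sum, hsum, inner_zero_right]
  rw [Finset.sum_eq_single_of_mem i his, Set.inter_assoc, Set.inter_self] at hzero
  · exact (mul_ne_zero hai ((measureReal_ne_zero_iff).2 (hμ i U hUmem))) hzero
  · intro j hj hji
    by_cases haj : a j = 0
    · simp [haj]
    have hdisj : U ∩ Set.Iic (v i) ∩ Set.Iic (v j) = ∅ := by
      refine Set.eq_empty_of_forall_notMem fun t ht => ?_
      exact Set.mem_iInter₂.1 ht.1.1 j (by simp [*]) ht.2
    simp [hdisj]

end LowerIndicator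

section FieldMeasure

/-- The measure on the line with an atom of mass `θ` at `0` and density `γ` on `(0,1)`. It is
chosen so that `θ + γ * min x y` is the mass of `Set.Iic x ∩ Set.Iic y` for `x, y ∈ (0,1)`. -/
noncomputable def coordMeasure (θ γ : ℝ) : Measure ℝ :=
  θ.toNNReal • Measure.dirac 0 + γ.toNNReal • volume.restrict (Set.Ioo 0 1)

instance (θ γ : ℝ) : IsFiniteMeasure (coordMeasure θ γ) := by
  unfold coordMeasure; infer_instance

lemma coordMeasure_real_Iic {θ γ x : ℝ} (hθ : 0 ≤ θ) (hγ : 0 ≤ γ) (hx : 0 < x) (hx1 : x < 1) :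
    (coordMeasure θ γ).real (Set.Iic x) = θ + γ * x := by
  have hIoc : Set.Iic x ∩ Set.Ioo 0 1 = Set.Ioc 0 x := by
    ext t; simp only [Set.mem_inter_iff, Set.mem_Iic, Set.mem_Ioo, Set.mem_Ioc]; grind
  rw [coordMeasure, measureReal_add_apply, measureReal_nnreal_smul_apply,
    measureReal_nnreal_smul_apply, measureReal_restrict_apply measurableSet_Iic, hIoc]
  simp [measureReal_def, hx.le, hθ, hγ]

lemma coordMeasure_Ioc_ne_zero (θ : ℝ) {γ a x : ℝ} (hγ : 0 < γ) (hx : 0 < x) (hx1 : x < 1)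
    (hax : a < x) : coordMeasure θ γ (Set.Ioc a x) ≠ 0 := by
  have hsub : Set.Ioo (max a 0) x ⊆ Set.Ioc a x ∩ Set.Ioo 0 1 := fun t ht =>
    ⟨⟨(le_max_left _ _).trans_lt ht.1, ht.2.le⟩, (le_max_right _ _).trans_lt ht.1, ht.2.trans hx1⟩
  have hpos : 0 < volume (Set.Ioc a x ∩ Set.Ioo 0 1) :=
    (by simp [hax, hx] : 0 < volume (Set.Ioo (max a 0) x)).trans_le (measure_mono hsub)
  rw [coordMeasure, Measure.add_apply, Measure.smul_apply, Measure.smul_apply,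
    Measure.restrict_apply measurableSet_Ioc]
  simp [hγ, hpos.ne']

variable {d : ℕ} {θ γ : Fin d → ℝ}

/-- The product of the measures `coordMeasure (θ j) (γ j)`, whose space `L²` carries a feature map
of the Brownian field kernel: `x ↦ lowerIndicator (fieldMeasure θ γ) x`. -/
noncomputable def fieldMeasure (θ γ : Fin d → ℝ) : Measure (Fin d → ℝ) :=
  Measure.pi fun j => coordMeasure (θ j) (γ j)

instance (θ γ : Fin d → ℝ) : IsFiniteMeasure (fieldMeasure θ γ) := by
  unfold fieldMeasure; infer_instance

lemma inner_lowerIndicator_fieldMeasure (hθ : ∀ j, 0 ≤ θ j) (hγ : ∀ j, 0 ≤ γ j)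
    {x y : Fin d → ℝ} (hx : x ∈ unitCube d) (hy : y ∈ unitCube d) :
    ⟪lowerIndicator (fieldMeasure θ γ) x, lowerIndicator (fieldMeasure θ γ) y⟫ =
      bfKernel θ γ x y := by
  rw [inner_lowerIndicator, Set.Iic_inter_Iic, ← Set.pi_univ_Iic, measureReal_def, fieldMeasure,
    Measure.pi_pi, ENNReal.toReal_prod]
  exact Finset.prod_congr rfl fun j _ => coordMeasure_real_Iic (hθ j) (hγ j)
    (lt_min (hx j).1 (hy j).1) (min_lt_of_left_lt (hx j).2)

lemma fieldMeasure_inter_Iic_ne_zero (hγ : ∀ j, 0 < γ j) {x : Fin d → ℝ} (hx : x ∈ unitCube d)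
    {U : Set (Fin d → ℝ)} (hU : U ∈ 𝓝 x) : fieldMeasure θ γ (U ∩ Set.Iic x) ≠ 0 := by
  obtain ⟨r, hr, hball⟩ := Metric.mem_nhds_iff.1 hU
  have hsub : (Set.univ.pi fun j => Set.Ioc (x j - r) (x j)) ⊆ U ∩ Set.Iic x := by
    refine fun t ht => ⟨hball ?_, fun j => (ht j trivial).2⟩
    refine (dist_pi_lt_iff hr).2 fun j => ?_
    rw [Real.dist_eq, abs_lt]
    constructor <;> linarith [(ht j trivial).1, (ht j trivial).2]
  refine mt (measure_mono_null hsub) ?_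
  rw [fieldMeasure, Measure.pi_pi]
  exact Finset.prod_ne_zero_iff.2 fun j _ =>
    coordMeasure_Ioc_ne_zero _ (hγ j) (hx j).1 (hx j).2 (sub_lt_self _ hr)

lemma linearIndependent_lowerIndicator_fieldMeasure (θ : Fin d → ℝ) (hγ : ∀ j, 0 < γ j)
    {ι : Type*} {v : ι → Fin d → ℝ} (hv : Function.Injective v) (hcube : ∀ i, v i ∈ unitCube d) :
    LinearIndependent ℝ fun i => lowerIndicator (fieldMeasure θ γ) (v i) :=
  linearIndependent_lowerIndicator _ hv fun i _ hU =>
    fieldMeasure_inter_Iic_ne_zero hγ (hcube i) hU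

end FieldMeasure

section GramProjection

variable {E ι : Type*} [NormedAddCommGroup E] [InnerProductSpace ℝ E] [Fintype ι] [DecidableEq ι]
  {v : ι → E}

lemma starProjection_span_range [(Submodule.span ℝ (Set.range v)).HasOrthogonalProjection]
    (hv : LinearIndependent ℝ v) (w : E) :
    (Submodule.span ℝ (Set.range v)).starProjection w =
      ∑ i, ((Matrix.gram ℝ v)⁻¹ *ᵥ fun j => ⟪v j, w⟫) i • v i := by
  set c := (Matrix.gram ℝ v)⁻¹ *ᵥ fun j => ⟪v j, w⟫
  have hc : Matrix.gram ℝ v *ᵥ c = fun j => ⟪v j, w⟫ := by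
    rw [Matrix.mulVec_mulVec, Matrix.mul_nonsing_inv _ (isUnit_iff_ne_zero.2
      (Matrix.det_gram_ne_zero_iff_linearIndependent.2 hv)), Matrix.one_mulVec]
  have horth (i : ι) : ⟪v i, w - ∑ j, c j • v j⟫ = 0 := by
    rw [inner_sub_right, inner_sum, ← congrFun hc i, sub_eq_zero]
    simp [Matrix.mulVec, dotProduct, Matrix.gram_apply, real_inner_smul_right, mul_comm]
  have hle : Submodule.span ℝ (Set.range v) ≤ (ℝ ∙ (w - ∑ j, c j • v j))ᗮ :=
    Submodule.span_le.2 <| Set.range_subset_iff.2 fun i =>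
      Submodule.mem_orthogonal_singleton_iff_inner_left.2 (horth i)
  exact Submodule.eq_starProjection_of_mem_of_inner_eq_zero
    (Submodule.sum_smul_mem _ _ fun i _ => Submodule.subset_span (Set.mem_range_self i))
    fun u hu => Submodule.mem_orthogonal_singleton_iff_inner_right.1 (hle hu)

lemma dotProduct_gram_inv_mulVec [(Submodule.span ℝ (Set.range v)).HasOrthogonalProjection]
    (hv : LinearIndependent ℝ v) (L : E →L[ℝ] ℝ) (w : E) :
    (fun i => ⟪v i, w⟫) ⬝ᵥ ((Matrix.gram ℝ v)⁻¹ *ᵥ fun i => L (v i)) =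
      L ((Submodule.span ℝ (Set.range v)).starProjection w) := by
  have hsymm : ((Matrix.gram ℝ v)⁻¹)ᵀ = (Matrix.gram ℝ v)⁻¹ := by
    rw [Matrix.transpose_nonsing_inv, Matrix.transpose, Matrix.gram]
    simp only [Matrix.of_apply, real_inner_comm]
  rw [starProjection_span_range hv w, map_sum, Matrix.dotProduct_mulVec, ← Matrix.mulVec_transpose,
    hsymm]
  simp only [dotProduct, map_smul, smul_eq_mul]

lemma norm_sub_starProjection_le {K : Submodule ℝ E} [K.HasOrthogonalProjection] (w : E) {u : E}
    (hu : u ∈ K) : ‖w - K.starProjection w‖ ≤ ‖w - u‖ := by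
  rw [K.starProjection_minimal]
  exact ciInf_le ⟨0, Set.forall_mem_range.2 fun _ => norm_nonneg _⟩ (⟨u, hu⟩ : K)

end GramProjection

section Interpolation

variable {d : ℕ} {θ γ : Fin d → ℝ} {x : ℕ → Fin d → ℝ} {n : ℕ} {z : Fin d → ℝ}

/-- The span of the features of the first `n` design points: the kernel interpolant from these
points is the orthogonal projection onto it, read through the feature map. -/
noncomputable def designSpan (θ γ : Fin d → ℝ) (x : ℕ → Fin d → ℝ) (n : ℕ) :
    Submodule ℝ (Lp ℝ 2 (fieldMeasure θ γ)) :=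
  Submodule.span ℝ (Set.range fun i : Fin n => lowerIndicator (fieldMeasure θ γ) (x i))

instance (θ γ : Fin d → ℝ) (x : ℕ → Fin d → ℝ) (n : ℕ) :
    FiniteDimensional ℝ (designSpan θ γ x n) :=
  FiniteDimensional.span_of_finite ℝ (Set.finite_range _)

lemma lowerIndicator_mem_designSpan (θ γ : Fin d → ℝ) (x : ℕ → Fin d → ℝ) {i n : ℕ}
    (hi : i < n) : lowerIndicator (fieldMeasure θ γ) (x i) ∈ designSpan θ γ x n :=
  Submodule.subset_span ⟨⟨i, hi⟩, rfl⟩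

lemma designSpan_mono (θ γ : Fin d → ℝ) (x : ℕ → Fin d → ℝ) : Monotone (designSpan θ γ x) :=
  fun _ _ hmn => Submodule.span_le.2 <| Set.range_subset_iff.2 fun i =>
    lowerIndicator_mem_designSpan θ γ x (i.2.trans_le hmn)

variable (hθ : ∀ j, 0 ≤ θ j) (hγ : ∀ j, 0 < γ j) (hcube : ∀ i < n, x i ∈ unitCube d)
  (hinj : Set.InjOn x (Set.Iio n))

include hγ hcube hinj in
lemma linearIndependent_design :
    LinearIndependent ℝ fun i : Fin n => lowerIndicator (fieldMeasure θ γ) (x i) :=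
  linearIndependent_lowerIndicator_fieldMeasure θ hγ (v := fun i : Fin n => x i)
    (fun i j hij => Fin.ext (hinj i.2 j.2 hij)) fun i => hcube i i.2

include hθ hγ hcube in
lemma gram_lowerIndicator_design :
    Matrix.gram ℝ (fun i : Fin n => lowerIndicator (fieldMeasure θ γ) (x i)) =
      kernelMatrix θ γ x n := by
  ext i j
  exact inner_lowerIndicator_fieldMeasure hθ (fun j => (hγ j).le) (hcube i i.2) (hcube j j.2)

include hθ hγ hcube hinj in
lemma kernelVec_dotProduct_kernelMatrix_inv_mulVec (hz : z ∈ unitCube d)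
    (L : Lp ℝ 2 (fieldMeasure θ γ) →L[ℝ] ℝ) :
    kernelVec θ γ x n z ⬝ᵥ ((kernelMatrix θ γ x n)⁻¹ *ᵥ
        fun i : Fin n => L (lowerIndicator (fieldMeasure θ γ) (x i))) =
      L ((designSpan θ γ x n).starProjection (lowerIndicator (fieldMeasure θ γ) z)) := by
  have hvec : kernelVec θ γ x n z = fun i : Fin n =>
      ⟪lowerIndicator (fieldMeasure θ γ) (x i), lowerIndicator (fieldMeasure θ γ) z⟫ :=
    funext fun i =>
      (inner_lowerIndicator_fieldMeasure hθ (fun j => (hγ j).le) (hcube i i.2) hz).symm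
  rw [hvec, ← gram_lowerIndicator_design hθ hγ hcube]
  have : (Submodule.span ℝ (Set.range fun i : Fin n =>
      lowerIndicator (fieldMeasure θ γ) (x i))).HasOrthogonalProjection :=
    inferInstanceAs (designSpan θ γ x n).HasOrthogonalProjection
  exact dotProduct_gram_inv_mulVec (linearIndependent_design hγ hcube hinj) L _

/-- `f` agrees on the unit cube with an element of the native space of the Brownian field kernel:
it is a bounded linear functional read through the feature map. -/
def MemNativeSpace (θ γ : Fin d → ℝ) (f : (Fin d → ℝ) → ℝ) : Prop :=
  ∃ L : Lp ℝ 2 (fieldMeasure θ γ) →L[ℝ] ℝ, ∀ z ∈ unitCube d,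
    f z = L (lowerIndicator (fieldMeasure θ γ) z)

include hθ hγ hcube hinj

lemma krr_eq_starProjection (L : Lp ℝ 2 (fieldMeasure θ γ) →L[ℝ] ℝ) {y : ℕ → ℝ}
    (hy : ∀ i < n, y i = L (lowerIndicator (fieldMeasure θ γ) (x i))) (hz : z ∈ unitCube d) :
    krr θ γ 0 x y n z =
      L ((designSpan θ γ x n).starProjection (lowerIndicator (fieldMeasure θ γ) z)) := by
  rw [← kernelVec_dotProduct_kernelMatrix_inv_mulVec hθ hγ hcube hinj hz, krr, mul_zero, zero_smul,
    add_zero]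
  simp only [hy _ (Fin.is_lt _)]

/-- The second stage interpolates the residual of the first one. As the two design spans are
nested, the sum of the two interpolants is the interpolant from all points. -/
lemma surrogateMean_eq_starProjection {n₀ : ℕ} (hn₀ : n₀ ≤ n)
    (L : Lp ℝ 2 (fieldMeasure θ γ) →L[ℝ] ℝ) {y : ℕ → ℝ}
    (hy : ∀ i < n, y i = L (lowerIndicator (fieldMeasure θ γ) (x i))) (hz : z ∈ unitCube d) :
    surrogateMean θ γ 0 0 (fun _ => 1) n₀ x y n z =
      L ((designSpan θ γ x n).starProjection (lowerIndicator (fieldMeasure θ γ) z)) := by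
  have hstage_one {w : Fin d → ℝ} (hw : w ∈ unitCube d) :=
    krr_eq_starProjection hθ hγ (fun i hi => hcube i (hi.trans_le hn₀))
      (hinj.mono (Set.Iio_subset_Iio hn₀)) L (fun i hi => hy i (hi.trans_le hn₀)) hw
  have hresidual : (fun i : Fin n => y i - krr θ γ 0 x y n₀ (x i)) = fun i : Fin n =>
      (L - L ∘L (designSpan θ γ x n₀).starProjection) (lowerIndicator (fieldMeasure θ γ) (x i)) :=
    funext fun i => by simp [hy i i.2, hstage_one (hcube i i.2)]
  have hnested (u : Lp ℝ 2 (fieldMeasure θ γ)) : (designSpan θ γ x n₀).starProjection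
      ((designSpan θ γ x n).starProjection u) = (designSpan θ γ x n₀).starProjection u :=
    DFunLike.congr_fun
      (Submodule.starProjection_comp_starProjection_of_le (designSpan_mono θ γ x hn₀)) u
  simp only [surrogateMean, one_pow, one_mul, one_smul, ne_eq, OfNat.ofNat_ne_zero,
    not_false_eq_true, zero_pow, zero_smul, add_zero]
  rw [hresidual, kernelVec_dotProduct_kernelMatrix_inv_mulVec hθ hγ hcube hinj hz, hstage_one hz]
  simp [hnested]

lemma surrogateVar_eq_norm_sq (hz : z ∈ unitCube d) :
    surrogateVar θ γ 0 (fun _ => 1) x n z =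
      ‖lowerIndicator (fieldMeasure θ γ) z -
        (designSpan θ γ x n).starProjection (lowerIndicator (fieldMeasure θ γ) z)‖ ^ 2 := by
  set φ := lowerIndicator (fieldMeasure θ γ) z
  set P := (designSpan θ γ x n).starProjection
  have hvec : kernelVec θ γ x n z = fun i : Fin n =>
      innerSL ℝ φ (lowerIndicator (fieldMeasure θ γ) (x i)) := funext fun i => by
    rw [innerSL_apply_apply, real_inner_comm]
    exact (inner_lowerIndicator_fieldMeasure hθ (fun j => (hγ j).le) (hcube i i.2) hz).symm
  have hquad := kernelVec_dotProduct_kernelMatrix_inv_mulVec hθ hγ hcube hinj hz (innerSL ℝ φ)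
  rw [← hvec, innerSL_apply_apply] at hquad
  simp only [surrogateVar, one_pow, one_mul, one_smul, ne_eq, OfNat.ofNat_ne_zero,
    not_false_eq_true, zero_pow, zero_smul, add_zero]
  calc bfKernel θ γ z z - kernelVec θ γ x n z ⬝ᵥ
        ((kernelMatrix θ γ x n)⁻¹ *ᵥ kernelVec θ γ x n z) = ⟪φ, φ - P φ⟫ := by
        rw [hquad, inner_sub_right,
          inner_lowerIndicator_fieldMeasure hθ (fun j => (hγ j).le) hz hz]
    _ = ⟪φ - P φ, φ - P φ⟫ := by
        rw [inner_sub_left, real_inner_comm _ (P φ),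
          Submodule.starProjection_inner_eq_zero _ _ (Submodule.starProjection_apply_mem _ _),
          sub_zero]
    _ = ‖φ - P φ‖ ^ 2 := real_inner_self_eq_norm_sq _

lemma surrogateVar_design {i : ℕ} (hi : i < n) : surrogateVar θ γ 0 (fun _ => 1) x n (x i) = 0 := by
  rw [surrogateVar_eq_norm_sq hθ hγ hcube hinj (hcube i hi), Submodule.starProjection_eq_self_iff.2
    (lowerIndicator_mem_designSpan θ γ x hi), sub_self, norm_zero, zero_pow two_ne_zero]

lemma surrogateVar_pos (hz : z ∈ unitCube d) (hnew : ∀ i < n, x i ≠ z) :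
    0 < surrogateVar θ γ 0 (fun _ => 1) x n z := by
  rw [surrogateVar_eq_norm_sq hθ hγ hcube hinj hz]
  refine pow_pos (norm_pos_iff.2 (sub_ne_zero.2 fun heq => ?_)) 2
  have hmem := Submodule.starProjection_eq_self_iff.1 heq.symm
  have hcons_inj : Function.Injective (Fin.cons z fun i : Fin n => x i : Fin (n + 1) → Fin d → ℝ) :=
    Fin.cons_injective_iff.2 ⟨by rintro ⟨i, hi⟩; exact hnew i i.2 hi,
      fun i j hij => Fin.ext (hinj i.2 j.2 hij)⟩
  have hindep := linearIndependent_lowerIndicator_fieldMeasure θ hγ hcons_inj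
    (Fin.cases hz fun i => hcube i i.2)
  exact (linearIndependent_finSucc.1 hindep).2 hmem

lemma abs_sub_surrogateMean_le {n₀ : ℕ} (hn₀ : n₀ ≤ n) {f : (Fin d → ℝ) → ℝ}
    {L : Lp ℝ 2 (fieldMeasure θ γ) →L[ℝ] ℝ}
    (hL : ∀ w ∈ unitCube d, f w = L (lowerIndicator (fieldMeasure θ γ) w)) (hz : z ∈ unitCube d)
    {u : Lp ℝ 2 (fieldMeasure θ γ)} (hu : u ∈ designSpan θ γ x n) :
    |f z - surrogateMean θ γ 0 0 (fun _ => 1) n₀ x (fun i => f (x i)) n z| ≤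
      ‖L‖ * ‖lowerIndicator (fieldMeasure θ γ) z - u‖ := by
  rw [surrogateMean_eq_starProjection hθ hγ hcube hinj hn₀ L (fun i hi => hL _ (hcube i hi)) hz,
    hL z hz, ← map_sub]
  exact (L.le_opNorm _).trans
    (mul_le_mul_of_nonneg_left (norm_sub_starProjection_le _ hu) (norm_nonneg L))

end Interpolation

section Tensor

variable {ι : Type*} [Fintype ι] {α : ι → Type*} [∀ j, MeasurableSpace (α j)]
  {μ : ∀ j, Measure (α j)} [∀ j, SigmaFinite (μ j)]

lemma memLp_two_prod_eval {u : ∀ j, α j → ℝ} (hu : ∀ j, MemLp (u j) 2 (μ j)) :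
    MemLp (fun t : ∀ j, α j => ∏ j, u j (t j)) 2 (Measure.pi μ) := by
  refine (memLp_two_iff_integrable_sq ?_).2 ?_
  · exact Finset.aestronglyMeasurable_fun_prod _ fun j _ =>
      (hu j).1.comp_quasiMeasurePreserving (Measure.quasiMeasurePreserving_eval μ j)
  · simpa only [← Finset.prod_pow] using Integrable.fintype_prod_dep fun j => (hu j).integrable_sq

lemma ae_pi_forall_eq {u v : ∀ j, α j → ℝ} (huv : ∀ j, u j =ᵐ[μ j] v j) :
    ∀ᵐ t ∂Measure.pi μ, ∀ j, u j (t j) = v j (t j) :=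
  ae_all_iff.2 fun j => (Measure.quasiMeasurePreserving_eval μ j).ae (huv j)

variable (μ) in
/-- The tensor product of square integrable functions of one variable each, as a multilinear map. -/
noncomputable def tensorLp :
    MultilinearMap ℝ (fun j => Lp ℝ 2 (μ j)) (Lp ℝ 2 (Measure.pi μ)) where
  toFun u := (memLp_two_prod_eval fun j => Lp.memLp (u j)).toLp
  map_update_add' u i v w := by
    rw [← MemLp.toLp_add, MemLp.toLp_eq_toLp_iff]
    filter_upwards [(Measure.quasiMeasurePreserving_eval μ i).ae (Lp.coeFn_add v w)] with t ht
    simp only [Pi.add_apply, Function.apply_update fun j (f : Lp ℝ 2 (μ j)) => f (t j),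
      Finset.prod_update_of_mem (Finset.mem_univ i), ht, add_mul]
  map_update_smul' u i c v := by
    rw [← MemLp.toLp_const_smul, MemLp.toLp_eq_toLp_iff]
    filter_upwards [(Measure.quasiMeasurePreserving_eval μ i).ae (Lp.coeFn_smul c v)] with t ht
    simp only [Pi.smul_apply, Function.apply_update fun j (f : Lp ℝ 2 (μ j)) => f (t j),
      Finset.prod_update_of_mem (Finset.mem_univ i), ht, smul_eq_mul, mul_assoc]

lemma coeFn_tensorLp (u : ∀ j, Lp ℝ 2 (μ j)) :
    tensorLp μ u =ᵐ[Measure.pi μ] fun t => ∏ j, u j (t j) :=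
  MemLp.coeFn_toLp (memLp_two_prod_eval fun j => Lp.memLp (u j))

lemma norm_sq_eq_integral {β : Type*} [MeasurableSpace β] {ν : Measure β} (u : Lp ℝ 2 ν) :
    ‖u‖ ^ 2 = ∫ t, u t ^ 2 ∂ν := by
  rw [← real_inner_self_eq_norm_sq, L2.inner_def]
  simp only [real_inner_self_eq_norm_sq, Real.norm_eq_abs, sq_abs]

lemma norm_tensorLp (u : ∀ j, Lp ℝ 2 (μ j)) : ‖tensorLp μ u‖ = ∏ j, ‖u j‖ := by
  refine (pow_left_inj₀ (norm_nonneg _) (Finset.prod_nonneg fun j _ => norm_nonneg _)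
    two_ne_zero).1 ?_
  calc ‖tensorLp μ u‖ ^ 2 = ∫ t, ∏ j, u j (t j) ^ 2 ∂Measure.pi μ := by
        rw [norm_sq_eq_integral]
        refine integral_congr_ae ((coeFn_tensorLp u).mono fun t ht => ?_)
        simp only [ht, Finset.prod_pow]
    _ = ∏ j, ∫ s, u j s ^ 2 ∂μ j := integral_fintype_prod_eq_prod fun j s => u j s ^ 2
    _ = (∏ j, ‖u j‖) ^ 2 := by simp only [norm_sq_eq_integral, ← Finset.prod_pow]

end Tensor

section TensorLowerIndicator

variable {ι : Type*} [Fintype ι] {α : ι → Type*} [∀ j, TopologicalSpace (α j)]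
  [∀ j, PartialOrder (α j)] [∀ j, OrderClosedTopology (α j)] [∀ j, MeasurableSpace (α j)]
  [∀ j, OpensMeasurableSpace (α j)] [OpensMeasurableSpace (∀ j, α j)]
  {μ : ∀ j, Measure (α j)} [∀ j, IsFiniteMeasure (μ j)]

lemma tensorLp_lowerIndicator (x : ∀ j, α j) :
    tensorLp μ (fun j => lowerIndicator (μ j) (x j)) = lowerIndicator (Measure.pi μ) x := by
  classical
  refine Lp.ext ?_
  filter_upwards [coeFn_tensorLp fun j => lowerIndicator (μ j) (x j),
    coeFn_lowerIndicator (Measure.pi μ) x,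
    ae_pi_forall_eq fun j => coeFn_lowerIndicator (μ j) (x j)] with t htensor hlower hcoord
  rw [htensor, hlower, Finset.prod_congr rfl fun j _ => hcoord j]
  simp [Set.indicator_apply, Pi.le_def, Finset.prod_ite_zero]

end TensorLowerIndicator

lemma multilinearMap_mem_span_image {R ι : Type*} {M : ι → Type*} {M' : Type*} [CommSemiring R]
    [Finite ι] [∀ i, AddCommMonoid (M i)] [∀ i, Module R (M i)] [AddCommMonoid M'] [Module R M']
    (T : MultilinearMap R M M') {s : ∀ i, Set (M i)} {u : ∀ i, M i}
    (hu : ∀ i, u i ∈ Submodule.span R (s i)) :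
    T u ∈ Submodule.span R (T '' Set.univ.pi s) := by
  classical
  have := Fintype.ofFinite ι
  choose n c g hg using fun i => Submodule.mem_span_set'.1 (hu i)
  obtain rfl : (fun i => ∑ k, c i k • (g i k : M i)) = u := funext hg
  rw [T.map_sum]
  refine Submodule.sum_mem _ fun r _ => ?_
  rw [T.map_smul_univ]
  exact Submodule.smul_mem _ _ (Submodule.subset_span ⟨_, fun i _ => (g i (r i)).2, rfl⟩)

section SparseGrid

lemma dyadicGrid_mono : Monotone dyadicGrid := by
  refine monotone_nat_of_le_succ fun l u hu => ?_
  obtain ⟨i, hi, rfl⟩ := Finset.mem_image.1 hu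
  rw [Finset.mem_Icc] at hi
  refine Finset.mem_image.2 ⟨2 * i, Finset.mem_Icc.2 (by grind), ?_⟩
  push_cast
  rw [pow_succ', mul_div_mul_left _ _ two_ne_zero]

lemma mem_Ioo_of_mem_dyadicGrid {l : ℕ} {u : ℝ} (hu : u ∈ dyadicGrid l) : 0 < u ∧ u < 1 := by
  obtain ⟨i, hi, rfl⟩ := Finset.mem_image.1 hu
  rw [Finset.mem_Icc] at hi
  have hlt : (i : ℝ) < 2 ^ l := by exact_mod_cast (by grind : i < 2 ^ l)
  exact ⟨div_pos (by exact_mod_cast hi.1) (by positivity), (div_lt_one (by positivity)).2 hlt⟩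

lemma card_dyadicGrid (l : ℕ) : (dyadicGrid l).card = 2 ^ l - 1 := by
  rw [dyadicGrid, Finset.card_image_of_injective, Nat.card_Icc, Nat.add_sub_cancel]
  exact fun i j hij => by simpa [div_left_inj'] using hij

lemma mem_unitCube_of_mem_sparseGrid {d τ : ℕ} {p : Fin d → ℝ} (hp : p ∈ sparseGrid d τ) :
    p ∈ unitCube d := by
  obtain ⟨l, -, hl⟩ := Finset.mem_biUnion.1 hp
  exact fun j => mem_Ioo_of_mem_dyadicGrid (Fintype.mem_piFinset.1 hl j)

lemma piFinset_dyadicGrid_subset_sparseGrid {d τ : ℕ} {l : Fin d → ℕ} (hl : ∑ j, l j < τ) :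
    Fintype.piFinset (fun j => dyadicGrid (l j + 1)) ⊆ sparseGrid d τ := by
  refine Finset.subset_biUnion_of_mem (fun l : Fin d → ℕ => Fintype.piFinset fun j =>
    dyadicGrid (l j)) (x := fun j => l j + 1) (Finset.mem_filter.2 ⟨?_, ?_⟩)
  · refine Fintype.mem_piFinset.2 fun j => Finset.mem_Icc.2 ⟨Nat.le_add_left _ _, ?_⟩
    exact (Finset.single_le_sum (fun _ _ => Nat.zero_le _) (Finset.mem_univ j)).trans_lt hl
  · simp only [Finset.sum_add_distrib, Finset.sum_const, Finset.card_univ, Fintype.card_fin,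
      smul_eq_mul, mul_one]
    omega

/-- All but one entry of `l` determine the last one once the sum is fixed, so that each value of
the sum is taken at most `m ^ e` times. -/
lemma sum_comp_sum_le {e m : ℕ} (T : Finset ℕ) {w : ℕ → ℝ} (hw : ∀ s, 0 ≤ w s)
    {A : Finset (Fin (e + 1) → ℕ)} (hm : ∀ l ∈ A, ∀ j, l j < m) (hA : ∀ l ∈ A, ∑ j, l j ∈ T) :
    ∑ l ∈ A, w (∑ j, l j) ≤ (m : ℝ) ^ e * ∑ s ∈ T, w s := by
  have hfiber (s : ℕ) : (A.filter fun l => ∑ j, l j = s).card ≤ m ^ e := by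
    calc (A.filter fun l => ∑ j, l j = s).card
        ≤ (Fintype.piFinset fun _ : Fin e => Finset.range m).card := by
          refine Finset.card_le_card_of_injOn Fin.tail (fun l hl => ?_) fun l hl l' hl' htail => ?_
          · exact Fintype.mem_piFinset.2 fun j =>
              Finset.mem_range.2 (hm l (Finset.mem_filter.1 hl).1 _)
          · have hsum := (Finset.mem_filter.1 hl).2.trans (Finset.mem_filter.1 hl').2.symm
            have hsucc (j : Fin e) : l j.succ = l' j.succ := congrFun htail j
            simp only [Fin.sum_univ_succ, hsucc, add_left_inj] at hsum
            exact funext (Fin.cases hsum hsucc)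
      _ = m ^ e := by simp
  rw [← Finset.sum_fiberwise_of_maps_to hA, Finset.mul_sum]
  refine Finset.sum_le_sum fun s _ => ?_
  rw [Finset.sum_congr rfl (g := fun _ => w s) fun l hl => by rw [(Finset.mem_filter.1 hl).2],
    Finset.sum_const, nsmul_eq_mul]
  exact mul_le_mul_of_nonneg_right (by exact_mod_cast hfiber s) (hw s)

lemma card_sparseGrid_le (e τ : ℕ) :
    ((sparseGrid (e + 1) τ).card : ℝ) ≤ (τ + 1 : ℝ) ^ e * 2 ^ (τ + e + 1) := by
  set A := (Fintype.piFinset fun _ : Fin (e + 1) => Finset.Icc 1 τ).filter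
    fun l => ∑ j, l j ≤ τ + (e + 1) - 1
  have hcard (l : Fin (e + 1) → ℕ) :
      (Fintype.piFinset fun j => dyadicGrid (l j)).card ≤ 2 ^ ∑ j, l j := by
    rw [Fintype.card_piFinset, ← Finset.prod_pow_eq_pow_sum]
    exact Finset.prod_le_prod' fun j _ => (card_dyadicGrid _).trans_le (Nat.sub_le _ _)
  calc ((sparseGrid (e + 1) τ).card : ℝ) ≤ ∑ l ∈ A, 2 ^ ∑ j, l j := by
        exact_mod_cast Finset.card_biUnion_le.trans (Finset.sum_le_sum fun l _ => hcard l)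
    _ ≤ ((τ + 1 : ℕ) : ℝ) ^ e * ∑ s ∈ Finset.range (τ + e + 1), 2 ^ s := by
        refine sum_comp_sum_le _ (fun _ => by positivity) (fun l hl j => ?_) fun l hl => ?_
        · have := Fintype.mem_piFinset.1 (Finset.mem_filter.1 hl).1 j
          grind
        · have := (Finset.mem_filter.1 hl).2
          grind
    _ ≤ (τ + 1 : ℝ) ^ e * 2 ^ (τ + e + 1) := by
        push_cast
        refine mul_le_mul_of_nonneg_left ?_ (by positivity)
        rw [geom_sum_eq (by norm_num)]
        norm_num

lemma le_card_sparseGrid (e : ℕ) {τ : ℕ} (hτ : 1 ≤ τ) :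
    2 ^ τ - 1 ≤ (sparseGrid (e + 1) τ).card := by
  obtain ⟨m, rfl⟩ := Nat.exists_eq_add_of_le' hτ
  have hsub := piFinset_dyadicGrid_subset_sparseGrid (τ := m + 1)
    (l := Fin.cons m fun _ : Fin e => 0) (by simp [Fin.sum_univ_succ])
  simpa [Fintype.card_piFinset, card_dyadicGrid, Fin.prod_univ_succ] using Finset.card_le_card hsub

end SparseGrid

section DyadicApproximation

/-- The point of the dyadic grid of level `l` next below `z`, or the least point of that grid. -/
noncomputable def gridPoint (l : ℕ) (z : ℝ) : ℝ := (max 1 ⌊z * 2 ^ l⌋₊ : ℕ) / 2 ^ l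

lemma gridPoint_mem_dyadicGrid {l : ℕ} (hl : 1 ≤ l) {z : ℝ} (hz : 0 < z ∧ z < 1) :
    gridPoint l z ∈ dyadicGrid l := by
  refine Finset.mem_image.2 ⟨_, Finset.mem_Icc.2 ⟨le_max_left _ _, ?_⟩, rfl⟩
  have htwo : 2 ≤ 2 ^ l := le_self_pow₀ one_le_two (by omega)
  have hfloor : ⌊z * 2 ^ l⌋₊ < 2 ^ l := by
    rw [Nat.floor_lt (mul_nonneg hz.1.le (by positivity))]
    exact_mod_cast mul_lt_of_lt_one_left (by positivity) hz.2
  omega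

lemma abs_gridPoint_sub_le (l : ℕ) {z : ℝ} (hz : 0 < z) : |gridPoint l z - z| ≤ (1 / 2) ^ l := by
  have hpow : (0 : ℝ) < 2 ^ l := by positivity
  have hle := Nat.floor_le (mul_pos hz hpow).le
  have hlt := Nat.lt_floor_add_one (z * 2 ^ l)
  have hscaled : |((max 1 ⌊z * 2 ^ l⌋₊ : ℕ) : ℝ) - z * 2 ^ l| ≤ 1 := by
    have := mul_pos hz hpow
    rcases Nat.eq_zero_or_pos ⌊z * 2 ^ l⌋₊ with hzero | hpos
    · rw [hzero] at hlt ⊢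
      rw [abs_le]
      constructor <;> norm_num at hlt ⊢ <;> linarith
    · rw [max_eq_right hpos, abs_le]
      constructor <;> linarith
  rw [gridPoint, div_sub' hpow.ne', abs_div, abs_of_pos hpow, one_div_pow, mul_comm _ z]
  exact div_le_div_of_nonneg_right hscaled hpow.le

/-- The dyadic approximation of `z` of level `l`, replaced by `z` itself above level `τ`. -/
noncomputable def dyadicNode (τ l : ℕ) (z : ℝ) : ℝ := if l ≤ τ then gridPoint l z else z

lemma dyadicNode_mem_Ioo (τ : ℕ) {l : ℕ} (hl : 1 ≤ l) {z : ℝ} (hz : 0 < z ∧ z < 1) :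
    0 < dyadicNode τ l z ∧ dyadicNode τ l z < 1 := by
  unfold dyadicNode
  split_ifs
  exacts [mem_Ioo_of_mem_dyadicGrid (gridPoint_mem_dyadicGrid hl hz), hz]

lemma abs_dyadicNode_sub_le (τ l : ℕ) {z : ℝ} (hz : 0 < z) :
    |dyadicNode τ l z - z| ≤ (1 / 2) ^ l := by
  unfold dyadicNode
  split_ifs
  exacts [abs_gridPoint_sub_le l hz, by simp]

/-- The successive dyadic approximations of the feature of `z`, starting from `0`. -/
noncomputable def dyadicApprox (μ : Measure ℝ) [IsFiniteMeasure μ] (τ : ℕ) (z : ℝ) : ℕ → Lp ℝ 2 μ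
  | 0 => 0
  | l + 1 => lowerIndicator μ (dyadicNode τ (l + 1) z)

/-- The increments of `dyadicApprox`. -/
noncomputable def dyadicDetail (μ : Measure ℝ) [IsFiniteMeasure μ] (τ : ℕ) (z : ℝ) (l : ℕ) :
    Lp ℝ 2 μ :=
  dyadicApprox μ τ z (l + 1) - dyadicApprox μ τ z l

lemma sum_dyadicDetail (μ : Measure ℝ) [IsFiniteMeasure μ] (τ : ℕ) (z : ℝ) :
    ∑ l ∈ Finset.range (τ + 1), dyadicDetail μ τ z l = lowerIndicator μ z := by
  simp only [dyadicDetail]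
  rw [Finset.sum_range_sub]
  simp [dyadicApprox, dyadicNode]

lemma dyadicApprox_mem_span (μ : Measure ℝ) [IsFiniteMeasure μ] {τ l m : ℕ} {z : ℝ}
    (hz : 0 < z ∧ z < 1) (hlτ : l ≤ τ) (hlm : l ≤ m) :
    dyadicApprox μ τ z l ∈ Submodule.span ℝ (lowerIndicator μ '' (dyadicGrid m : Set ℝ)) := by
  cases l with
  | zero => exact Submodule.zero_mem _
  | succ l =>
    refine Submodule.subset_span (Set.mem_image_of_mem _ (dyadicGrid_mono hlm ?_))
    rw [dyadicNode, if_pos hlτ]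
    exact gridPoint_mem_dyadicGrid (Nat.le_add_left 1 l) hz

lemma dyadicDetail_mem_span (μ : Measure ℝ) [IsFiniteMeasure μ] {τ l : ℕ} {z : ℝ}
    (hz : 0 < z ∧ z < 1) (hl : l < τ) :
    dyadicDetail μ τ z l ∈
      Submodule.span ℝ (lowerIndicator μ '' (dyadicGrid (l + 1) : Set ℝ)) :=
  Submodule.sub_mem _ (dyadicApprox_mem_span μ hz hl le_rfl)
    (dyadicApprox_mem_span μ hz hl.le (Nat.le_succ l))

variable {θ γ : ℝ} (hθ : 0 ≤ θ) (hγ : 0 ≤ γ)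

include hθ hγ

lemma inner_lowerIndicator_coordMeasure {x y : ℝ} (hx : 0 < x ∧ x < 1) (hy : 0 < y ∧ y < 1) :
    ⟪lowerIndicator (coordMeasure θ γ) x, lowerIndicator (coordMeasure θ γ) y⟫ =
      θ + γ * min x y := by
  rw [inner_lowerIndicator, Set.Iic_inter_Iic]
  exact coordMeasure_real_Iic hθ hγ (lt_min hx.1 hy.1) (min_lt_of_left_lt hx.2)

lemma norm_sq_lowerIndicator_sub {x y : ℝ} (hx : 0 < x ∧ x < 1) (hy : 0 < y ∧ y < 1) :
    ‖lowerIndicator (coordMeasure θ γ) x - lowerIndicator (coordMeasure θ γ) y‖ ^ 2 =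
      γ * |x - y| := by
  rw [norm_sub_sq_real, ← real_inner_self_eq_norm_sq, ← real_inner_self_eq_norm_sq,
    inner_lowerIndicator_coordMeasure hθ hγ hx hx, inner_lowerIndicator_coordMeasure hθ hγ hx hy,
    inner_lowerIndicator_coordMeasure hθ hγ hy hy, min_self, min_self, abs_sub_comm]
  linear_combination -γ * two_nsmul_inf_eq_add_sub_abs_sub x y

lemma norm_sq_dyadicDetail_le (τ l : ℕ) {z : ℝ} (hz : 0 < z ∧ z < 1) :
    ‖dyadicDetail (coordMeasure θ γ) τ z l‖ ^ 2 ≤ (θ + 2 * γ) * (1 / 2) ^ l := by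
  cases l with
  | zero =>
    have hnode := dyadicNode_mem_Ioo τ le_rfl hz
    simp only [dyadicDetail, dyadicApprox, sub_zero, zero_add, pow_zero, mul_one]
    rw [← real_inner_self_eq_norm_sq, inner_lowerIndicator_coordMeasure hθ hγ hnode hnode, min_self]
    nlinarith
  | succ l =>
    have hdist : |dyadicNode τ (l + 2) z - dyadicNode τ (l + 1) z| ≤ 2 * (1 / 2) ^ (l + 1) := by
      have hfine := abs_dyadicNode_sub_le τ (l + 2) hz.1
      have hcoarse := abs_dyadicNode_sub_le τ (l + 1) hz.1
      have htri := abs_sub_le (dyadicNode τ (l + 2) z) z (dyadicNode τ (l + 1) z)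
      rw [abs_sub_comm z] at htri
      rw [pow_succ _ (l + 1)] at hfine
      linarith [pow_pos (one_half_pos (α := ℝ)) (l + 1)]
    calc ‖dyadicDetail (coordMeasure θ γ) τ z (l + 1)‖ ^ 2
        = γ * |dyadicNode τ (l + 2) z - dyadicNode τ (l + 1) z| :=
          norm_sq_lowerIndicator_sub hθ hγ (dyadicNode_mem_Ioo τ (Nat.le_add_left 1 _) hz)
            (dyadicNode_mem_Ioo τ (Nat.le_add_left 1 _) hz)
      _ ≤ γ * (2 * (1 / 2) ^ (l + 1)) := mul_le_mul_of_nonneg_left hdist hγ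
      _ ≤ (θ + 2 * γ) * (1 / 2) ^ (l + 1) := by
          linarith [mul_nonneg hθ (pow_nonneg (one_half_pos (α := ℝ)).le (l + 1))]

lemma norm_dyadicDetail_le (τ l : ℕ) {z : ℝ} (hz : 0 < z ∧ z < 1) :
    ‖dyadicDetail (coordMeasure θ γ) τ z l‖ ≤ √(θ + 2 * γ) * √(1 / 2) ^ l := by
  have hsum : 0 ≤ θ + 2 * γ := by positivity
  refine le_of_sq_le_sq ?_ (by positivity)
  rw [mul_pow, ← pow_mul, mul_comm l, pow_mul, Real.sq_sqrt hsum, Real.sq_sqrt one_half_pos.le]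
  exact norm_sq_dyadicDetail_le hθ hγ τ l hz

end DyadicApproximation

section SparseGridApproximation

variable {d : ℕ} {θ γ : Fin d → ℝ}

/-- The tensor products of the increments `dyadicDetail`, which decompose the feature of `z`. -/
noncomputable def tensorDetail (θ γ : Fin d → ℝ) (τ : ℕ) (z : Fin d → ℝ) (l : Fin d → ℕ) :
    Lp ℝ 2 (fieldMeasure θ γ) :=
  tensorLp (fun j => coordMeasure (θ j) (γ j)) fun j =>
    dyadicDetail (coordMeasure (θ j) (γ j)) τ (z j) (l j)

lemma sum_tensorDetail (θ γ : Fin d → ℝ) (τ : ℕ) (z : Fin d → ℝ) :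
    ∑ l ∈ Fintype.piFinset fun _ : Fin d => Finset.range (τ + 1), tensorDetail θ γ τ z l =
      lowerIndicator (fieldMeasure θ γ) z := by
  refine (MultilinearMap.map_sum_finset (tensorLp fun j => coordMeasure (θ j) (γ j))
    (fun j l => dyadicDetail _ τ (z j) l) fun _ => Finset.range (τ + 1)).symm.trans ?_
  simp only [sum_dyadicDetail]
  exact tensorLp_lowerIndicator z

lemma tensorDetail_mem_span (θ γ : Fin d → ℝ) {τ : ℕ} {z : Fin d → ℝ} (hz : z ∈ unitCube d)
    {l : Fin d → ℕ} (hl : ∑ j, l j < τ) :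
    tensorDetail θ γ τ z l ∈ Submodule.span ℝ
      (lowerIndicator (fieldMeasure θ γ) '' (sparseGrid d τ : Set (Fin d → ℝ))) := by
  have hlt (j : Fin d) : l j < τ :=
    (Finset.single_le_sum (fun _ _ => Nat.zero_le _) (Finset.mem_univ j)).trans_lt hl
  refine Submodule.span_mono ?_ (multilinearMap_mem_span_image
    (tensorLp fun j => coordMeasure (θ j) (γ j)) fun j => dyadicDetail_mem_span _ (hz j) (hlt j))
  rintro _ ⟨u, hu, rfl⟩
  choose p hp hpu using fun j => hu j trivial
  obtain rfl : (fun j => lowerIndicator (coordMeasure (θ j) (γ j)) (p j)) = u := funext hpu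
  exact ⟨p, piFinset_dyadicGrid_subset_sparseGrid hl (Fintype.mem_piFinset.2 hp),
    (tensorLp_lowerIndicator p).symm⟩

lemma norm_tensorDetail_le (hθ : ∀ j, 0 ≤ θ j) (hγ : ∀ j, 0 ≤ γ j) (τ : ℕ) {z : Fin d → ℝ}
    (hz : z ∈ unitCube d) (l : Fin d → ℕ) :
    ‖tensorDetail θ γ τ z l‖ ≤ (∏ j, √(θ j + 2 * γ j)) * √(1 / 2) ^ ∑ j, l j := by
  rw [← Finset.prod_pow_eq_pow_sum, ← Finset.prod_mul_distrib]
  exact (norm_tensorLp _).trans_le <| Finset.prod_le_prod (fun j _ => norm_nonneg _) fun j _ =>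
    norm_dyadicDetail_le (hθ j) (hγ j) τ (l j) (hz j)

lemma exists_mem_span_norm_lowerIndicator_sub_le {e : ℕ} {θ γ : Fin (e + 1) → ℝ}
    (hθ : ∀ j, 0 ≤ θ j) (hγ : ∀ j, 0 ≤ γ j) (τ : ℕ) {z : Fin (e + 1) → ℝ}
    (hz : z ∈ unitCube (e + 1)) :
    ∃ u ∈ Submodule.span ℝ (lowerIndicator (fieldMeasure θ γ) ''
        (sparseGrid (e + 1) τ : Set (Fin (e + 1) → ℝ))),
      ‖lowerIndicator (fieldMeasure θ γ) z - u‖ ≤ (∏ j, √(θ j + 2 * γ j)) *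
        ((τ + 1 : ℝ) ^ e * (√(1 / 2) ^ τ / (1 - √(1 / 2)))) := by
  set r : ℝ := √(1 / 2)
  have hr : r < 1 := (Real.sqrt_lt' one_pos).2 (by norm_num)
  let I := Fintype.piFinset fun _ : Fin (e + 1) => Finset.range (τ + 1)
  let A := I.filter fun l => ¬ ∑ j, l j < τ
  refine ⟨∑ l ∈ I with ∑ j, l j < τ, tensorDetail θ γ τ z l, Submodule.sum_mem _ fun l hl =>
    tensorDetail_mem_span θ γ hz (Finset.mem_filter.1 hl).2, ?_⟩
  have hgeom : ∑ l ∈ A, r ^ ∑ j, l j ≤ (τ + 1 : ℝ) ^ e * (r ^ τ / (1 - r)) := by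
    calc ∑ l ∈ A, r ^ ∑ j, l j
        ≤ ((τ + 1 : ℕ) : ℝ) ^ e *
            ∑ s ∈ Finset.Ico τ (A.sup (fun l => ∑ j, l j) + 1), r ^ s := by
          refine sum_comp_sum_le _ (fun s => by positivity) (fun l hl j => ?_) fun l hl => ?_
          · exact Finset.mem_range.1 (Fintype.mem_piFinset.1 (Finset.mem_filter.1 hl).1 j)
          · exact Finset.mem_Ico.2 ⟨not_lt.1 (Finset.mem_filter.1 hl).2,
              Nat.lt_succ_of_le (Finset.le_sup (f := fun l => ∑ j, l j) hl)⟩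
      _ ≤ (τ + 1 : ℝ) ^ e * (r ^ τ / (1 - r)) := by
          push_cast
          exact mul_le_mul_of_nonneg_left
            (geom_sum_Ico_le_of_lt_one (Real.sqrt_nonneg _) hr) (by positivity)
  rw [← sum_tensorDetail θ γ τ z, ← Finset.sum_filter_add_sum_filter_not I (∑ j, · j < τ),
    add_sub_cancel_left]
  calc ‖∑ l ∈ A, tensorDetail θ γ τ z l‖
      ≤ ∑ l ∈ A, (∏ j, √(θ j + 2 * γ j)) * r ^ ∑ j, l j :=
        norm_sum_le_of_le _ fun l _ => norm_tensorDetail_le hθ hγ τ hz l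
    _ ≤ (∏ j, √(θ j + 2 * γ j)) * ((τ + 1 : ℝ) ^ e * (r ^ τ / (1 - r))) := by
        rw [← Finset.mul_sum]
        exact mul_le_mul_of_nonneg_left hgeom (Finset.prod_nonneg fun j _ => Real.sqrt_nonneg _)

end SparseGridApproximation

section InfoValue

lemma hasDerivAt_gaussianPDFReal (s : ℝ) :
    HasDerivAt (gaussianPDFReal 0 1) (-s * gaussianPDFReal 0 1 s) s := by
  have hexp : HasDerivAt (fun s => (√(2 * Real.pi))⁻¹ * Real.exp (-s ^ 2 / 2))
      ((√(2 * Real.pi))⁻¹ * (Real.exp (-s ^ 2 / 2) * (-(2 * s) / 2))) s := by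
    simpa using (((hasDerivAt_pow 2 s).neg.div_const 2).exp).const_mul (√(2 * Real.pi))⁻¹
  simp only [gaussianPDFReal_def, NNReal.coe_one, mul_one, sub_zero]
  exact hexp.congr_deriv (by ring)

lemma integrable_neg_mul_gaussianPDFReal : Integrable fun s => -s * gaussianPDFReal 0 1 s := by
  convert (integrable_mul_exp_neg_mul_sq one_half_pos).const_mul (-(√(2 * Real.pi))⁻¹) using 2
    with s
  simp only [gaussianPDFReal, NNReal.coe_one, mul_one, sub_zero]
  ring_nf

lemma integral_Iic_neg_mul_gaussianPDFReal (t : ℝ) :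
    ∫ s in Set.Iic t, -s * gaussianPDFReal 0 1 s = gaussianPDFReal 0 1 t := by
  have hint := integrable_neg_mul_gaussianPDFReal.integrableOn (s := Set.Iic t)
  rw [integral_Iic_of_hasDerivAt_of_tendsto' (fun s _ => hasDerivAt_gaussianPDFReal s) hint
    (tendsto_zero_of_hasDerivAt_of_integrableOn_Iic (fun s _ => hasDerivAt_gaussianPDFReal s) hint
      (integrable_gaussianPDFReal 0 1).integrableOn), sub_zero]

lemma cdf_gaussianReal_eq (t : ℝ) :
    cdf (gaussianReal 0 1) t = ∫ s in Set.Iic t, gaussianPDFReal 0 1 s := by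
  rw [cdf_eq_real, measureReal_def, gaussianReal_apply_eq_integral _ one_ne_zero,
    ENNReal.toReal_ofReal (integral_nonneg fun s => gaussianPDFReal_nonneg _ _ _)]

lemma integrable_sub_mul_gaussianPDFReal (t : ℝ) :
    Integrable fun s => (t - s) * gaussianPDFReal 0 1 s := by
  refine (((integrable_gaussianPDFReal 0 1).const_mul t).add
    integrable_neg_mul_gaussianPDFReal).congr (.of_forall fun s => ?_)
  simp only [Pi.add_apply]
  ring

lemma infoValue_eq_integral (t : ℝ) :
    infoValue t = ∫ s in Set.Iic t, (t - s) * gaussianPDFReal 0 1 s := by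
  rw [infoValue, cdf_gaussianReal_eq, ← integral_Iic_neg_mul_gaussianPDFReal, ← integral_const_mul,
    ← integral_add ((integrable_gaussianPDFReal 0 1).integrableOn.const_mul t)
      integrable_neg_mul_gaussianPDFReal.integrableOn]
  simp only [← add_mul, ← sub_eq_add_neg]

lemma infoValue_pos (t : ℝ) : 0 < infoValue t := by
  rw [infoValue_eq_integral, setIntegral_pos_iff_support_of_nonneg_ae ?_
    (integrable_sub_mul_gaussianPDFReal t).integrableOn]
  · have hsub : Set.Iio t ⊆
        Function.support (fun s => (t - s) * gaussianPDFReal 0 1 s) ∩ Set.Iic t := fun s hs =>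
      ⟨mul_ne_zero (sub_pos.2 hs).ne' (gaussianPDFReal_pos _ _ _ one_ne_zero).ne',
        Set.Iio_subset_Iic_self hs⟩
    exact (by simp : 0 < volume (Set.Iio t)).trans_le (measure_mono hsub)
  · exact (ae_restrict_iff' measurableSet_Iic).2 <| .of_forall fun s hs =>
      mul_nonneg (sub_nonneg.2 hs) (gaussianPDFReal_nonneg _ _ _)

end InfoValue

section Run

variable {d : ℕ} {θ γ : Fin d → ℝ} {N τ : ℕ} {x : ℕ → Fin d → ℝ} {y : ℕ → ℝ}

lemma IsKEIBSRun.mem_unitCube {σ lam : ℝ} {δ : ℕ → ℝ} (hrun : IsKEIBSRun θ γ σ lam δ N τ x y)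
    {i : ℕ} (hi : i < N) : x i ∈ unitCube d := by
  by_cases hgrid : i < (sparseGrid d τ).card
  · exact mem_unitCube_of_mem_sparseGrid
      (hrun.stage_one ▸ Finset.mem_image_of_mem x (Finset.mem_range.2 hgrid))
  · exact mem_unitCube_of_mem_sparseGrid (hrun.stage_two i (not_lt.1 hgrid) hi).1

lemma IsKEIBSRun.injOn_stage_one {σ lam : ℝ} {δ : ℕ → ℝ} (hrun : IsKEIBSRun θ γ σ lam δ N τ x y) :
    Set.InjOn x (Set.Iio (sparseGrid d τ).card) := by
  rw [← Finset.coe_range, ← Finset.card_image_iff, hrun.stage_one, Finset.card_range]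

lemma IsKEIBSRun.exists_unsampled {σ lam : ℝ} {δ : ℕ → ℝ} (hrun : IsKEIBSRun θ γ σ lam δ N τ x y)
    {n : ℕ} (hn : n < N) : ∃ z ∈ sparseGrid d (τ + 1), ∀ i < n, x i ≠ z := by
  have hcard : ((Finset.range n).image x).card < (sparseGrid d (τ + 1)).card := by
    refine (Finset.card_image_le.trans_eq (Finset.card_range n)).trans_lt (hn.trans hrun.lt_card)
  obtain ⟨z, hz, hznew⟩ := Finset.exists_mem_notMem_of_card_lt_card hcard
  exact ⟨z, hz, fun i hi hiz =>
    hznew (hiz ▸ Finset.mem_image_of_mem x (Finset.mem_range.2 hi))⟩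

variable (hθ : ∀ j, 0 ≤ θ j) (hγ : ∀ j, 0 < γ j)

include hθ hγ

lemma IsKEIBSRun.ne_stage_two (hrun : IsKEIBSRun θ γ 0 0 (fun _ => 1) N τ x y) {n : ℕ}
    (hn : (sparseGrid d τ).card ≤ n) (hnN : n < N) (hinj : Set.InjOn x (Set.Iio n)) :
    ∀ i < n, x i ≠ x n := by
  intro i hi heq
  have hcube : ∀ i < n, x i ∈ unitCube d := fun i hi => hrun.mem_unitCube (hi.trans hnN)
  obtain ⟨z, hz, hznew⟩ := hrun.exists_unsampled hnN
  have hpos : 0 < expectedImprovement θ γ 0 0 (fun _ => 1) (sparseGrid d τ).card x y n z :=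
    mul_pos (Real.sqrt_pos.2 (surrogateVar_pos hθ hγ hcube hinj
      (mem_unitCube_of_mem_sparseGrid hz) hznew)) (infoValue_pos _)
  have hzero : expectedImprovement θ γ 0 0 (fun _ => 1) (sparseGrid d τ).card x y n (x n) = 0 := by
    rw [← heq, expectedImprovement, surrogateVar_design hθ hγ hcube hinj hi, Real.sqrt_zero,
      zero_mul]
  exact hpos.not_ge (((hrun.stage_two n hn hnN).2 hz).trans_eq hzero)

lemma IsKEIBSRun.injOn (hrun : IsKEIBSRun θ γ 0 0 (fun _ => 1) N τ x y) :
    Set.InjOn x (Set.Iio N) := by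
  suffices hinj : ∀ n, (sparseGrid d τ).card ≤ n → n ≤ N → Set.InjOn x (Set.Iio n) from
    hinj N hrun.card_le le_rfl
  intro n hn
  induction n, hn using Nat.le_induction with
  | base => exact fun _ => hrun.injOn_stage_one
  | succ n hn ih =>
    intro hnN
    have hinj := ih (Nat.le_of_succ_le hnN)
    rw [← Order.succ_eq_add_one, Order.Iio_succ_eq_insert, Set.injOn_insert Set.self_notMem_Iio]
    exact ⟨hinj, fun ⟨i, hi, heq⟩ => hrun.ne_stage_two hθ hγ hn hnN hinj i hi heq⟩

end Run

section Rate

lemma level_add_two_le {e N τ : ℕ} (hN : 2 ≤ N) (hτ : 1 ≤ τ)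
    (hcard : (sparseGrid (e + 1) τ).card ≤ N) : (τ + 2 : ℝ) ≤ 4 / Real.log 2 * Real.log N := by
  have hlog : Real.log 2 ≤ Real.log N := Real.log_le_log two_pos (by exact_mod_cast hN)
  have hpow : 2 ^ τ ≤ N ^ 2 := by
    have := le_card_sparseGrid e hτ
    calc 2 ^ τ ≤ N + 1 := by omega
      _ ≤ N ^ 2 := by nlinarith
  have hlevel : (τ : ℝ) * Real.log 2 ≤ 2 * Real.log N := by
    rw [← Real.log_pow, ← Nat.cast_two (R := ℝ), ← Real.log_pow]
    exact Real.log_le_log (by positivity) (by exact_mod_cast hpow)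
  rw [div_mul_eq_mul_div, le_div_iff₀ (Real.log_pos one_lt_two)]
  linarith

lemma sqrt_half_pow_mul_sqrt_le {e N τ : ℕ} (hN : N < (sparseGrid (e + 1) (τ + 1)).card) :
    √(1 / 2) ^ τ * √N ≤ √((τ + 2 : ℝ) ^ e * 2 ^ (e + 2)) := by
  have hpow : √(1 / 2) ^ τ = √((1 / 2) ^ τ) := by
    rw [eq_comm, Real.sqrt_eq_iff_mul_self_eq (by positivity) (by positivity), ← mul_pow,
      Real.mul_self_sqrt (by norm_num)]
  rw [hpow, ← Real.sqrt_mul (by positivity)]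
  refine Real.sqrt_le_sqrt ?_
  calc (1 / 2 : ℝ) ^ τ * N ≤ (1 / 2) ^ τ * (((τ + 1 : ℕ) + 1) ^ e * 2 ^ (τ + 1 + e + 1)) := by
        gcongr
        exact (Nat.cast_le.2 hN.le).trans (card_sparseGrid_le e (τ + 1))
    _ = ((1 / 2) ^ τ * 2 ^ τ) * ((τ + 2 : ℝ) ^ e * 2 ^ (e + 2)) := by push_cast; ring
    _ = (τ + 2 : ℝ) ^ e * 2 ^ (e + 2) := by
        rw [← mul_pow, one_div_mul_cancel two_ne_zero, one_pow, one_mul]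

lemma pow_mul_sqrt_pow {L : ℝ} (hL : 0 < L) (e : ℕ) :
    L ^ e * √(L ^ e) = L ^ (3 * (e : ℝ) / 2) := by
  rw [Real.sqrt_eq_rpow, ← Real.rpow_natCast, ← Real.rpow_mul hL.le, ← Real.rpow_add hL]
  congr 1; ring

lemma exists_pow_mul_sqrt_half_pow_le (e : ℕ) :
    ∃ C : ℝ, ∀ N τ : ℕ, 2 ≤ N → 1 ≤ τ → (sparseGrid (e + 1) τ).card ≤ N →
      N < (sparseGrid (e + 1) (τ + 1)).card →
        (τ + 1 : ℝ) ^ e * √(1 / 2) ^ τ ≤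
          C * ((N : ℝ) ^ (-(1 / 2) : ℝ) * Real.log N ^ (3 * (e : ℝ) / 2)) := by
  set A : ℝ := 4 / Real.log 2
  have : 0 < A := div_pos four_pos (Real.log_pos one_lt_two)
  refine ⟨A ^ e * √(A ^ e * 2 ^ (e + 2)), fun N τ hN hτ hcard hlt => ?_⟩
  have hNpos : (0 : ℝ) < N := by exact_mod_cast (by omega : 0 < N)
  have hlevel := level_add_two_le hN hτ hcard
  have hL : 0 < Real.log N := Real.log_pos (by exact_mod_cast (by omega : 1 < N))
  set L := Real.log N
  have hsqrt : √(1 / 2) ^ τ ≤ √((A * L) ^ e * 2 ^ (e + 2)) / √N := by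
    rw [le_div_iff₀ (Real.sqrt_pos.2 hNpos)]
    refine (sqrt_half_pow_mul_sqrt_le hlt).trans ?_
    gcongr
  calc (τ + 1 : ℝ) ^ e * √(1 / 2) ^ τ
      ≤ (A * L) ^ e * (√((A * L) ^ e * 2 ^ (e + 2)) / √N) := by
        gcongr
        linarith
    _ = A ^ e * √(A ^ e * 2 ^ (e + 2)) * ((N : ℝ) ^ (-(1 / 2) : ℝ) * (L ^ e * √(L ^ e))) := by
        rw [mul_pow, mul_right_comm (A ^ e) (L ^ e) (2 ^ (e + 2)),
          Real.sqrt_mul' _ (by positivity : 0 ≤ L ^ e), Real.rpow_neg hNpos.le, ← Real.sqrt_eq_rpow]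
        ring
    _ = A ^ e * √(A ^ e * 2 ^ (e + 2)) *
          ((N : ℝ) ^ (-(1 / 2) : ℝ) * L ^ (3 * (e : ℝ) / 2)) := by rw [pow_mul_sqrt_pow hL]

end Rate

section UniformBound

lemma IsKEIBSRun.span_sparseGrid_le_designSpan {d : ℕ} {θ γ : Fin d → ℝ} {σ lam : ℝ} {δ : ℕ → ℝ}
    {N τ : ℕ} {x : ℕ → Fin d → ℝ} {y : ℕ → ℝ} (hrun : IsKEIBSRun θ γ σ lam δ N τ x y) :
    Submodule.span ℝ (lowerIndicator (fieldMeasure θ γ) ''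
      (sparseGrid d τ : Set (Fin d → ℝ))) ≤ designSpan θ γ x N := by
  refine Submodule.span_le.2 (Set.image_subset_iff.2 fun p hp => ?_)
  rw [Finset.mem_coe, ← hrun.stage_one] at hp
  obtain ⟨i, hi, rfl⟩ := Finset.mem_image.1 hp
  exact lowerIndicator_mem_designSpan θ γ x ((Finset.mem_range.1 hi).trans_le hrun.card_le)

lemma MemNativeSpace.exists_abs_sub_surrogateMean_le {e : ℕ} {θ γ : Fin (e + 1) → ℝ}
    (hθ : ∀ j, 0 ≤ θ j) (hγ : ∀ j, 0 < γ j) {f : (Fin (e + 1) → ℝ) → ℝ}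
    (hf : MemNativeSpace θ γ f) :
    ∃ C : ℝ, ∀ N : ℕ, 2 ≤ N → ∀ (τ : ℕ) (x : ℕ → Fin (e + 1) → ℝ),
      IsKEIBSRun θ γ 0 0 (fun _ => 1) N τ x (fun i => f (x i)) → ∀ z ∈ unitCube (e + 1),
        |f z - surrogateMean θ γ 0 0 (fun _ => 1) (sparseGrid (e + 1) τ).card x
          (fun i => f (x i)) N z| ≤
          C * ((N : ℝ) ^ (-(1 / 2) : ℝ) * Real.log N ^ (3 * (e : ℝ) / 2)) := by
  obtain ⟨L, hL⟩ := hf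
  obtain ⟨C, hC⟩ := exists_pow_mul_sqrt_half_pow_le e
  set r : ℝ := √(1 / 2)
  have hr : 0 ≤ 1 - r := sub_nonneg.2 (Real.sqrt_le_one.2 (by norm_num))
  set K : ℝ := ∏ j, √(θ j + 2 * γ j)
  have : 0 ≤ K := Finset.prod_nonneg fun j _ => Real.sqrt_nonneg _
  refine ⟨‖L‖ * (K / (1 - r)) * C, fun N hN τ x hrun z hz => ?_⟩
  obtain ⟨u, hu, hzu⟩ :=
    exists_mem_span_norm_lowerIndicator_sub_le hθ (fun j => (hγ j).le) τ hz
  calc |f z - surrogateMean θ γ 0 0 (fun _ => 1) (sparseGrid (e + 1) τ).card x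
          (fun i => f (x i)) N z|
      ≤ ‖L‖ * ‖lowerIndicator (fieldMeasure θ γ) z - u‖ :=
        abs_sub_surrogateMean_le hθ hγ (fun i => hrun.mem_unitCube) (hrun.injOn hθ hγ)
          hrun.card_le hL hz (hrun.span_sparseGrid_le_designSpan hu)
    _ ≤ ‖L‖ * (K * ((τ + 1 : ℝ) ^ e * (r ^ τ / (1 - r)))) := by gcongr
    _ = ‖L‖ * (K / (1 - r)) * ((τ + 1 : ℝ) ^ e * r ^ τ) := by ring
    _ ≤ ‖L‖ * (K / (1 - r)) *
          (C * ((N : ℝ) ^ (-(1 / 2) : ℝ) * Real.log N ^ (3 * (e : ℝ) / 2))) := by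
        exact mul_le_mul_of_nonneg_left
          (hC N τ hN hrun.one_le_level hrun.card_le hrun.lt_card) (by positivity)
    _ = ‖L‖ * (K / (1 - r)) * C *
          ((N : ℝ) ^ (-(1 / 2) : ℝ) * Real.log N ^ (3 * (e : ℝ) / 2)) := by ring

end UniformBound

lemma forall_piecewise {ι β : Type*} [DecidableEq ι] {P : β → Prop} {u v : ι → β}
    (S : Finset ι) (hu : ∀ j, P (u j)) (hv : ∀ j, P (v j)) (j : ι) : P (S.piecewise u v j) :=
  S.piecewise_cases u v P (hu j) (hv j)

section ProductFunctions

variable {ι : Type*} [Fintype ι] {α : ι → Type*}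

lemma prod_add_eval_eq_sum_piecewise {R : Type*} [CommSemiring R] [DecidableEq ι]
    (u v : ∀ j, α j → R) (y : ∀ j, α j) :
    ∏ j, (u j (y j) + v j (y j)) = ∑ S : Finset ι, ∏ j, S.piecewise u v j (y j) := by
  rw [Fintype.prod_add]
  refine Finset.sum_congr rfl fun S _ => ?_
  rw [← Finset.prod_mul_prod_compl S]
  refine congrArg₂ _ (Finset.prod_congr rfl fun j hj => ?_) (Finset.prod_congr rfl fun j hj => ?_)
  · rw [Finset.piecewise_eq_of_mem _ _ _ hj]
  · rw [Finset.piecewise_eq_of_notMem _ _ _ (Finset.mem_compl.1 hj)]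

lemma abs_prod_eval_le {u : ∀ j, α j → ℝ} {B : ι → ℝ} (hB : ∀ j t, |u j t| ≤ B j)
    (y : ∀ j, α j) : |∏ j, u j (y j)| ≤ ∏ j, B j := by
  rw [Finset.abs_prod]
  exact Finset.prod_le_prod (fun _ _ => abs_nonneg _) fun j _ => hB j (y j)

variable [∀ j, MeasurableSpace (α j)]

lemma measurable_prod_eval {u : ∀ j, α j → ℝ} (hu : ∀ j, Measurable (u j)) :
    Measurable fun y : ∀ j, α j => ∏ j, u j (y j) :=
  Finset.measurable_fun_prod _ fun j _ => (hu j).comp (measurable_pi_apply j)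

lemma memLp_mul_prod_eval {μ : Measure (∀ j, α j)} {p : ENNReal} {G : (∀ j, α j) → ℝ}
    (hG : MemLp G p μ) {u : ∀ j, α j → ℝ} (hu : ∀ j, Measurable (u j))
    (hbdd : ∀ j, ∃ B, ∀ t, |u j t| ≤ B) : MemLp (fun y => G y * ∏ j, u j (y j)) p μ := by
  choose B hB using hbdd
  refine hG.of_le_mul (c := ∏ j, B j)
    (hG.1.mul (measurable_prod_eval hu).aestronglyMeasurable) (.of_forall fun y => ?_)
  rw [norm_mul, mul_comm]
  exact mul_le_mul_of_nonneg_right (abs_prod_eval_le hB y) (norm_nonneg _)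

lemma integrable_mul_prod_eval {μ : Measure (∀ j, α j)} {G : (∀ j, α j) → ℝ}
    (hG : Integrable G μ) {u : ∀ j, α j → ℝ} (hu : ∀ j, Measurable (u j))
    (hbdd : ∀ j, ∃ B, ∀ t, |u j t| ≤ B) : Integrable (fun y => G y * ∏ j, u j (y j)) μ :=
  memLp_one_iff_integrable.1 (memLp_mul_prod_eval (memLp_one_iff_integrable.2 hG) hu hbdd)

end ProductFunctions

section UnitCube

variable (d : ℕ)

lemma unitCube_eq_pi : unitCube d = Set.univ.pi fun _ => Set.Ioo 0 1 := by
  ext; simp [unitCube]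

lemma measurableSet_unitCube : MeasurableSet (unitCube d) := by
  rw [unitCube_eq_pi]
  exact .univ_pi fun _ => measurableSet_Ioo

lemma volume_restrict_unitCube :
    volume.restrict (unitCube d) = Measure.pi fun _ => volume.restrict (Set.Ioo 0 1) := by
  rw [unitCube_eq_pi, volume_pi, Measure.restrict_pi_pi]

instance : IsProbabilityMeasure (volume.restrict (Set.Ioo (0 : ℝ) 1)) :=
  ⟨by simp⟩

instance : IsProbabilityMeasure (volume.restrict (unitCube d)) := by
  rw [volume_restrict_unitCube]
  infer_instance

end UnitCube

section ProductTestFunctions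

variable {d : ℕ} {v : Fin d → ℝ → ℝ}

lemma partialDeriv_prod (hv : ∀ j, Differentiable ℝ (v j)) (i : Fin d) :
    partialDeriv i (fun y => ∏ j, v j (y j)) =
      fun y => ∏ j, Function.update v i (deriv (v i)) j (y j) := by
  ext y
  have hderiv (j : Fin d) : HasFDerivAt (fun y : Fin d → ℝ => v j (y j))
      (deriv (v j) (y j) • ContinuousLinearMap.proj (R := ℝ) (φ := fun _ : Fin d => ℝ) j) y :=
    (hv j (y j)).hasDerivAt.comp_hasFDerivAt y (hasFDerivAt_apply j y)
  rw [partialDeriv, (HasFDerivAt.finsetProd fun j _ => hderiv j).fderiv, sum_apply,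
    Finset.sum_eq_single_of_mem i (Finset.mem_univ i) fun j _ hj => by simp [hj],
    ← Finset.prod_erase_mul _ _ (Finset.mem_univ i)]
  have herase : ∀ j ∈ Finset.univ.erase i, Function.update v i (deriv (v i)) j = v j :=
    fun j hj => Function.update_of_ne (Finset.ne_of_mem_erase hj) _ _
  rw [Finset.prod_congr rfl fun j hj => congrFun (herase j hj) (y j)]
  simp

lemma foldr_partialDeriv_prod (hv : ∀ j, ContDiff ℝ ∞ (v j)) {l : List (Fin d)} (hl : l.Nodup) :
    l.foldr partialDeriv (fun y => ∏ j, v j (y j)) =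
      fun y => ∏ j, l.toFinset.piecewise (fun j => deriv (v j)) v j (y j) := by
  induction l with
  | nil => rfl
  | cons i l ih =>
    obtain ⟨hil, hl⟩ := List.nodup_cons.1 hl
    have hdiff := forall_piecewise (P := Differentiable ℝ) l.toFinset
      (fun j => (contDiff_infty_iff_deriv.1 (hv j)).2.differentiable (by simp))
      fun j => (hv j).differentiable (by simp)
    rw [List.foldr_cons, ih hl, partialDeriv_prod hdiff, List.toFinset_cons,
      Finset.piecewise_insert, Finset.piecewise_eq_of_notMem _ _ _ (by simpa using hil)]

lemma mixedPartial_prod (hv : ∀ j, ContDiff ℝ ∞ (v j)) (S : Finset (Fin d)) :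
    mixedPartial S (fun y => ∏ j, v j (y j)) =
      fun y => ∏ j, S.piecewise (fun j => deriv (v j)) v j (y j) := by
  rw [mixedPartial, foldr_partialDeriv_prod hv (Finset.sort_nodup _ _), Finset.sort_toFinset]

lemma IsWeakMixedPartial.integral_mul_prod {S : Finset (Fin d)} {f g : (Fin d → ℝ) → ℝ}
    (hg : IsWeakMixedPartial S f g) (hv : ∀ j, ContDiff ℝ ∞ (v j))
    (hsupp : ∀ j, tsupport (v j) ⊆ Set.Ioo 0 1) :
    ∫ y in unitCube d, f y * ∏ j, S.piecewise (fun j => deriv (v j)) v j (y j) =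
      (-1) ^ S.card * ∫ y in unitCube d, g y * ∏ j, v j (y j) := by
  have hcompact : IsCompact (Set.univ.pi fun j => tsupport (v j)) :=
    isCompact_univ_pi fun j => isCompact_Icc.of_isClosed_subset (isClosed_tsupport _)
      ((hsupp j).trans Set.Ioo_subset_Icc_self)
  have hsub : Function.support (fun y : Fin d → ℝ => ∏ j, v j (y j)) ⊆
      Set.univ.pi fun j => tsupport (v j) := fun y hy j _ =>
    subset_tsupport _ (Finset.prod_ne_zero_iff.1 hy j (Finset.mem_univ j))
  have hcube : (Set.univ.pi fun j => tsupport (v j)) ⊆ unitCube d :=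
    unitCube_eq_pi d ▸ Set.pi_mono fun j _ => hsupp j
  simpa only [mixedPartial_prod hv] using
    hg (fun y => ∏ j, v j (y j))
      (contDiff_prod fun j _ => (hv j).comp (contDiff_apply ℝ ℝ j))
      (.of_support_subset_isCompact hcompact hsub)
      ((closure_minimal hsub hcompact.isClosed).trans hcube)

end ProductTestFunctions

section Mollifiers

/-- `ρ` is a smooth probability density on the line that vanishes outside `(a, b)`. -/
structure IsMollifier (ρ : ℝ → ℝ) (a b : ℝ) : Prop where
  contDiff : ContDiff ℝ ∞ ρ
  nonneg : ∀ t, 0 ≤ ρ t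
  integral_eq_one : ∫ t, ρ t = 1
  support_subset : Function.support ρ ⊆ Set.Ioo a b

lemma exists_isMollifier {a b : ℝ} (hab : a < b) : ∃ ρ, IsMollifier ρ a b := by
  let φ : ContDiffBump ((a + b) / 2) := ⟨(b - a) / 4, (b - a) / 2, by linarith, by linarith⟩
  refine ⟨φ.normed volume, φ.contDiff_normed, φ.nonneg_normed, φ.integral_normed, ?_⟩
  rw [φ.support_normed_eq, Real.ball_eq_Ioo]
  exact Set.Ioo_subset_Ioo (by simp only [φ]; linarith) (by simp only [φ]; linarith)

/-- The primitive of `ρ` that vanishes at `-∞`. -/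
noncomputable def primitive (ρ : ℝ → ℝ) (y : ℝ) : ℝ := ∫ t in Set.Iic y, ρ t

namespace IsMollifier

variable {ρ w : ℝ → ℝ} {a b c e y : ℝ}

lemma mono (hρ : IsMollifier ρ a b) (hca : c ≤ a) (hbe : b ≤ e) : IsMollifier ρ c e :=
  { hρ with support_subset := hρ.support_subset.trans (Set.Ioo_subset_Ioo hca hbe) }

lemma eq_zero (hρ : IsMollifier ρ a b) (hy : y ∉ Set.Ioo a b) : ρ y = 0 :=
  Function.notMem_support.1 fun h => hy (hρ.support_subset h)

lemma hasCompactSupport (hρ : IsMollifier ρ a b) : HasCompactSupport ρ :=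
  .of_support_subset_isCompact isCompact_Icc (hρ.support_subset.trans Set.Ioo_subset_Icc_self)

lemma tsupport_subset (hρ : IsMollifier ρ a b) : tsupport ρ ⊆ Set.Icc a b :=
  closure_minimal (hρ.support_subset.trans Set.Ioo_subset_Icc_self) isClosed_Icc

lemma exists_abs_le (hρ : IsMollifier ρ a b) : ∃ B, ∀ t, |ρ t| ≤ B :=
  hρ.hasCompactSupport.exists_bound_of_continuous hρ.contDiff.continuous

lemma integrable (hρ : IsMollifier ρ a b) : Integrable ρ :=
  hρ.contDiff.continuous.integrable_of_hasCompactSupport hρ.hasCompactSupport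

lemma primitive_eq_zero (hρ : IsMollifier ρ a b) (hy : y ≤ a) : primitive ρ y = 0 :=
  setIntegral_eq_zero_of_forall_eq_zero fun _ ht =>
    hρ.eq_zero fun h => (h.1.trans_le (Set.mem_Iic.1 ht)).not_ge hy

lemma primitive_eq_one (hρ : IsMollifier ρ a b) (hy : b ≤ y) : primitive ρ y = 1 :=
  (setIntegral_eq_integral_of_forall_compl_eq_zero fun _ ht =>
    hρ.eq_zero fun h => ht (h.2.le.trans hy)).trans hρ.integral_eq_one

lemma primitive_mem_Icc (hρ : IsMollifier ρ a b) (y : ℝ) : primitive ρ y ∈ Set.Icc 0 1 :=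
  ⟨integral_nonneg hρ.nonneg,
    hρ.integral_eq_one ▸ setIntegral_le_integral hρ.integrable (.of_forall hρ.nonneg)⟩

lemma abs_primitive_sub_primitive_le (hρ : IsMollifier ρ a b) (hw : IsMollifier w c e) (y : ℝ) :
    |primitive ρ y - primitive w y| ≤ 1 :=
  (Real.dist_le_of_mem_Icc_01 (hρ.primitive_mem_Icc y) (hw.primitive_mem_Icc y))

lemma hasDerivAt_primitive (hρ : IsMollifier ρ a b) (y : ℝ) :
    HasDerivAt (primitive ρ) (ρ y) y := by
  have heq : primitive ρ = fun y => primitive ρ 0 + ∫ t in (0 : ℝ)..y, ρ t := by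
    ext y
    rw [← intervalIntegral.integral_Iic_sub_Iic hρ.integrable.integrableOn
      hρ.integrable.integrableOn]
    simp [primitive]
  have hcont := hρ.contDiff.continuous
  rw [heq]
  exact (intervalIntegral.integral_hasDerivAt_right (hcont.intervalIntegrable _ _)
    (hcont.stronglyMeasurableAtFilter _ _) hcont.continuousAt).const_add _

lemma deriv_primitive (hρ : IsMollifier ρ a b) : deriv (primitive ρ) = ρ :=
  funext fun y => (hρ.hasDerivAt_primitive y).deriv

lemma contDiff_primitive (hρ : IsMollifier ρ a b) : ContDiff ℝ ∞ (primitive ρ) :=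
  contDiff_infty_iff_deriv.2 ⟨fun y => (hρ.hasDerivAt_primitive y).differentiableAt,
    hρ.deriv_primitive.symm ▸ hρ.contDiff⟩

lemma deriv_primitive_sub_primitive (hρ : IsMollifier ρ a b) (hw : IsMollifier w c e) :
    deriv (primitive ρ - primitive w) = ρ - w :=
  funext fun y => ((hρ.hasDerivAt_primitive y).sub (hw.hasDerivAt_primitive y)).deriv

lemma tsupport_primitive_sub_primitive_subset (hρ : IsMollifier ρ a b) (hw : IsMollifier w a b) :
    tsupport (primitive ρ - primitive w) ⊆ Set.Icc a b := by
  refine closure_minimal (fun y hy => ?_) isClosed_Icc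
  by_contra hyab
  rcases not_and_or.1 hyab with h | h
  · exact hy (by simp [hρ.primitive_eq_zero (not_le.1 h).le, hw.primitive_eq_zero (not_le.1 h).le])
  · exact hy (by simp [hρ.primitive_eq_one (not_le.1 h).le, hw.primitive_eq_one (not_le.1 h).le])

end IsMollifier

variable {d : ℕ} {f : (Fin d → ℝ) → ℝ} {ρ w : Fin d → ℝ → ℝ} {a b : Fin d → ℝ}

lemma IsWeakMixedPartial.integral_mul_prod_mollifier {S : Finset (Fin d)} {g : (Fin d → ℝ) → ℝ}
    (hg : IsWeakMixedPartial S f g) (ha : ∀ j, 0 < a j) (hb : ∀ j, b j < 1)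
    (hρ : ∀ j, IsMollifier (ρ j) (a j) (b j)) (hw : ∀ j, IsMollifier (w j) (a j) (b j)) :
    ∫ y in unitCube d, f y * ∏ j, S.piecewise (ρ - w) w j (y j) =
      (-1) ^ S.card * ∫ y in unitCube d,
        g y * ∏ j, S.piecewise (fun j => primitive (ρ j) - primitive (w j)) w j (y j) := by
  have hderiv : S.piecewise (ρ - w) w = S.piecewise
      (fun j => deriv (S.piecewise (fun j => primitive (ρ j) - primitive (w j)) w j))
      (S.piecewise (fun j => primitive (ρ j) - primitive (w j)) w) := by
    ext j : 1
    by_cases hj : j ∈ S <;> simp [hj, (hρ j).deriv_primitive_sub_primitive (hw j)]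
  rw [hderiv, hg.integral_mul_prod]
  · exact forall_piecewise S
      (fun j => (hρ j).contDiff_primitive.sub (hw j).contDiff_primitive) fun j => (hw j).contDiff
  · exact forall_piecewise (P := (tsupport · ⊆ Set.Ioo 0 1)) S
      (fun j => ((hρ j).tsupport_primitive_sub_primitive_subset (hw j)).trans
        (Set.Icc_subset_Ioo (ha j) (hb j)))
      fun j => (hw j).tsupport_subset.trans (Set.Icc_subset_Ioo (ha j) (hb j))

/-- Expand each factor as `ρ j = (ρ j - w j) + w j` and move the derivative off the terms
`ρ j - w j`, which have a compactly supported primitive because `ρ j` and `w j` have the same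
mass. -/
lemma integral_mul_prod_mollifier (hf : Integrable f (volume.restrict (unitCube d)))
    {g : Finset (Fin d) → (Fin d → ℝ) → ℝ} (hg : ∀ S, IsWeakMixedPartial S f (g S))
    (ha : ∀ j, 0 < a j) (hb : ∀ j, b j < 1)
    (hρ : ∀ j, IsMollifier (ρ j) (a j) (b j)) (hw : ∀ j, IsMollifier (w j) (a j) (b j)) :
    ∫ y in unitCube d, f y * ∏ j, ρ j (y j) = ∑ S, (-1) ^ S.card * ∫ y in unitCube d,
      g S y * ∏ j, S.piecewise (fun j => primitive (ρ j) - primitive (w j)) w j (y j) := by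
  have hexpand (y : Fin d → ℝ) :
      f y * ∏ j, ρ j (y j) = ∑ S : Finset (Fin d), f y * ∏ j, S.piecewise (ρ - w) w j (y j) := by
    rw [← Finset.mul_sum, ← prod_add_eval_eq_sum_piecewise]
    simp
  simp only [← (hg _).integral_mul_prod_mollifier ha hb hρ hw, hexpand]
  refine integral_finsetSum _ fun S _ => integrable_mul_prod_eval hf ?_ ?_
  · exact forall_piecewise S
      (fun j => ((hρ j).contDiff.sub (hw j).contDiff).continuous.measurable)
      fun j => (hw j).contDiff.continuous.measurable
  · refine forall_piecewise (P := fun u : ℝ → ℝ => ∃ B, ∀ t, |u t| ≤ B) S (fun j => ?_)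
      fun j => (hw j).exists_abs_le
    obtain ⟨B, hB⟩ := (hρ j).exists_abs_le
    obtain ⟨B', hB'⟩ := (hw j).exists_abs_le
    exact ⟨B + B', fun t => (abs_sub _ _).trans (add_le_add (hB t) (hB' t))⟩

end Mollifiers

section IntegralRepresentation

lemma IsMollifier.tendsto_primitive {κ : Type*} {l : Filter κ} {ρ : κ → ℝ → ℝ} {a : ℝ} {b : κ → ℝ}
    (hρ : ∀ n, IsMollifier (ρ n) a (b n)) (hb : Tendsto b l (𝓝 a)) (y : ℝ) :
    Tendsto (fun n => primitive (ρ n) y) l (𝓝 (1 - (Set.Iic a).indicator 1 y)) := by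
  refine tendsto_const_nhds.congr' ?_
  by_cases hya : y ≤ a
  · exact .of_forall fun n => by simp [(hρ n).primitive_eq_zero hya, hya]
  · filter_upwards [hb.eventually_lt_const (not_le.1 hya)] with n hn
    simp [(hρ n).primitive_eq_one hn.le, hya]

variable {d : ℕ} {f : (Fin d → ℝ) → ℝ} {x : Fin d → ℝ}

lemma integral_prod_mollifier {ρ : Fin d → ℝ → ℝ} {a b : Fin d → ℝ} (ha : ∀ j, 0 ≤ a j)
    (hb : ∀ j, b j ≤ 1) (hρ : ∀ j, IsMollifier (ρ j) (a j) (b j)) :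
    ∫ y in unitCube d, ∏ j, ρ j (y j) = 1 := by
  rw [volume_restrict_unitCube, integral_fintype_prod_eq_prod]
  refine Finset.prod_eq_one fun j _ => ?_
  have hzero : ∀ t ∉ Set.Ioo 0 1, ρ j t = 0 := fun t ht =>
    (hρ j).eq_zero fun h => ht ⟨(ha j).trans_lt h.1, h.2.trans_le (hb j)⟩
  rw [setIntegral_eq_integral_of_forall_compl_eq_zero hzero, (hρ j).integral_eq_one]

lemma tendsto_integral_mul_prod_mollifier (hf : Integrable f (volume.restrict (unitCube d)))
    (hfx : ContinuousWithinAt f (unitCube d) x) (hx : x ∈ unitCube d) {κ : Type*} {l : Filter κ}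
    {ρ : κ → Fin d → ℝ → ℝ} {b : κ → Fin d → ℝ}
    (hρ : ∀ n j, IsMollifier (ρ n j) (x j) (b n j)) (hb : ∀ n j, b n j ≤ 1)
    (hbx : Tendsto b l (𝓝 x)) :
    Tendsto (fun n => ∫ y in unitCube d, f y * ∏ j, ρ n j (y j)) l (𝓝 (f x)) := by
  have hmeas := measurableSet_unitCube d
  have hfinite : volume (unitCube d) ≠ ⊤ := by
    rw [← Measure.restrict_apply_univ]
    exact measure_ne_top _ _
  have hconcentrate : ∀ U : Set (Fin d → ℝ), IsOpen U → x ∈ U →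
      TendstoUniformlyOn (fun n y => ∏ j, ρ n j (y j)) 0 l (unitCube d \ U) := by
    intro U hU hxU
    obtain ⟨r, hr, hball⟩ := Metric.isOpen_iff.1 hU x hxU
    refine Metric.tendstoUniformlyOn_iff.2 fun δ hδ => ?_
    filter_upwards [eventually_all.2 fun j =>
      (tendsto_pi_nhds.1 hbx j).eventually_lt_const (lt_add_of_pos_right _ hr)] with n hn y hy
    have hzero : ∏ j, ρ n j (y j) = 0 := by
      by_contra hne
      have hIoo (j : Fin d) : y j ∈ Set.Ioo (x j) (b n j) :=
        (hρ n j).support_subset (Finset.prod_ne_zero_iff.1 hne j (Finset.mem_univ j))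
      refine hy.2 (hball ((dist_pi_lt_iff hr).2 fun j => ?_))
      rw [Real.dist_eq, abs_of_pos (sub_pos.2 (hIoo j).1)]
      linarith [(hIoo j).2, hn j]
    simpa [hzero] using hδ
  have hmass (n : κ) : ∫ y in unitCube d, ∏ j, ρ n j (y j) = 1 :=
    integral_prod_mollifier (fun j => (hx j).1.le) (hb n) (hρ n)
  simpa only [smul_eq_mul, mul_comm] using
    tendsto_setIntegral_peak_smul_of_integrableOn_of_tendsto hmeas hmeas subset_rfl
      self_mem_nhdsWithin hfinite
      (.of_forall fun n y _ => Finset.prod_nonneg fun j _ => (hρ n j).nonneg _) hconcentrate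
      (tendsto_const_nhds.congr fun n => (hmass n).symm)
      (.of_forall fun n => (measurable_prod_eval fun j =>
        (hρ n j).contDiff.continuous.measurable).aestronglyMeasurable) hf hfx

lemma tendsto_integral_mul_prod_primitive {g : (Fin d → ℝ) → ℝ}
    (hg : Integrable g (volume.restrict (unitCube d))) (S : Finset (Fin d)) {w : ℝ → ℝ} {p q : ℝ}
    (hw : IsMollifier w p q) {ρ : ℕ → Fin d → ℝ → ℝ} {b : ℕ → Fin d → ℝ}
    (hρ : ∀ n j, IsMollifier (ρ n j) (x j) (b n j)) (hbx : Tendsto b atTop (𝓝 x)) :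
    Tendsto (fun n => ∫ y in unitCube d, g y *
        ∏ j, S.piecewise (fun j => primitive (ρ n j) - primitive w) (fun _ => w) j (y j)) atTop
      (𝓝 (∫ y in unitCube d, g y * ∏ j, S.piecewise
        (fun j => 1 - (Set.Iic (x j)).indicator 1 - primitive w) (fun _ => w) j (y j))) := by
  obtain ⟨B, hB⟩ := hw.exists_abs_le
  have hbdd (n : ℕ) : ∀ j t,
      |S.piecewise (fun j => primitive (ρ n j) - primitive w) (fun _ => w) j t| ≤ max 1 B :=
    forall_piecewise (P := fun u : ℝ → ℝ => ∀ t, |u t| ≤ max 1 B) S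
      (fun j t => ((hρ n j).abs_primitive_sub_primitive_le hw t).trans (le_max_left _ _))
      fun _ t => (hB t).trans (le_max_right _ _)
  have hmeas (n : ℕ) : ∀ j,
      Measurable (S.piecewise (fun j => primitive (ρ n j) - primitive w) (fun _ => w) j) :=
    forall_piecewise S
      (fun j => ((hρ n j).contDiff_primitive.sub hw.contDiff_primitive).continuous.measurable)
      fun _ => hw.contDiff.continuous.measurable
  refine tendsto_integral_of_dominated_convergence (fun y => |g y| * ∏ _j : Fin d, max 1 B)
    (fun n => (integrable_mul_prod_eval hg (hmeas n) fun j => ⟨_, hbdd n j⟩).1)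
    (hg.abs.mul_const _) (fun n => .of_forall fun y => ?_) (.of_forall fun y => ?_)
  · rw [norm_mul]
    exact mul_le_mul_of_nonneg_left (abs_prod_eval_le (hbdd n) y) (abs_nonneg _)
  · refine .const_mul _ (tendsto_finsetProd _ fun j _ => ?_)
    by_cases hj : j ∈ S
    · simpa [hj] using (IsMollifier.tendsto_primitive (fun n => hρ n j)
        (tendsto_pi_nhds.1 hbx j) (y j)).sub_const (primitive w (y j))
    · simp [hj]

lemma eq_sum_integral_weakMixedPartial (hf : Integrable f (volume.restrict (unitCube d)))
    {g : Finset (Fin d) → (Fin d → ℝ) → ℝ} (hg : ∀ S, IsWeakMixedPartial S f (g S))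
    (hgint : ∀ S, Integrable (g S) (volume.restrict (unitCube d))) {w : ℝ → ℝ} {p q : ℝ}
    (hp : 0 < p) (hq : q < 1) (hw : IsMollifier w p q) (hx : x ∈ unitCube d)
    (hfx : ContinuousWithinAt f (unitCube d) x) :
    f x = ∑ S, (-1) ^ S.card * ∫ y in unitCube d, g S y *
      ∏ j, S.piecewise (fun j => 1 - (Set.Iic (x j)).indicator 1 - primitive w)
        (fun _ => w) j (y j) := by
  choose b _ hb hbx using fun j => exists_seq_strictAnti_tendsto' (hx j).2
  choose ρ hρ using fun n j => exists_isMollifier (hb j n).1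
  have hbx' : Tendsto (fun n j => b j n) atTop (𝓝 x) := tendsto_pi_nhds.2 hbx
  refine tendsto_nhds_unique (tendsto_integral_mul_prod_mollifier hf hfx hx hρ
    (fun n j => (hb j n).2.le) hbx') ?_
  have hparts (n : ℕ) := integral_mul_prod_mollifier hf hg
    (fun j => lt_min (hx j).1 hp) (fun j => max_lt (hb j n).2 hq)
    (fun j => (hρ n j).mono (min_le_left _ p) (le_max_left _ q))
    fun j => hw.mono (min_le_right (x j) _) (le_max_right (b j n) _)
  simp only [hparts]
  exact tendsto_finsetSum _ fun S _ =>
    (tendsto_integral_mul_prod_primitive (hgint S) S hw hρ hbx').const_mul _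

end IntegralRepresentation

section MeasureDomination

lemma pi_le_prod_smul_pi {ι : Type*} [Fintype ι] {α : ι → Type*} [∀ j, MeasurableSpace (α j)]
    {ν μ : ∀ j, Measure (α j)} [∀ j, SigmaFinite (ν j)] [∀ j, SigmaFinite (μ j)] {c : ι → NNReal}
    (hle : ∀ j, ν j ≤ c j • μ j) : Measure.pi ν ≤ (∏ j, c j) • Measure.pi μ := by
  have hsmul : Measure.pi (fun j => c j • μ j) = (∏ j, c j) • Measure.pi μ :=
    Measure.pi_eq fun s _ => by
      simp only [Measure.smul_apply, Measure.pi_pi, ENNReal.smul_def, smul_eq_mul,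
        Finset.prod_mul_distrib, ENNReal.ofNNReal_finsetProd]
  have houter : (Measure.pi ν).toOuterMeasure ≤
      OuterMeasure.pi fun j => (c j • μ j).toOuterMeasure :=
    OuterMeasure.le_pi.2 fun s _ =>
      (Measure.pi_pi ν s).trans_le (Finset.prod_le_prod' fun j _ => hle j (s j))
  rw [← hsmul]
  refine Measure.le_iff.2 fun s hs => (houter s).trans_eq ?_
  rw [Measure.pi, toMeasure_apply _ _ hs]

lemma exists_continuousLinearMap_comp {α β E : Type*} [MeasurableSpace α] [MeasurableSpace β]
    [NormedAddCommGroup E] [NormedSpace ℝ E] {p : ENNReal} [Fact (1 ≤ p)] {μ : Measure α}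
    {ν : Measure β} {T : α → β} (hT : Measurable T) {c : NNReal} (hle : μ.map T ≤ c • ν) :
    ∃ L : Lp E p ν →L[ℝ] Lp E p μ, ∀ u, L u =ᵐ[μ] u ∘ T := by
  have hle' : μ.map T ≤ (c : ENNReal) • ν := hle
  have hac : μ.map T ≪ ν := Measure.absolutelyContinuous_of_le_smul hle'
  have hcomp (u : Lp E p ν) : MemLp (u ∘ T) p μ :=
    ((Lp.memLp u).of_measure_le_smul ENNReal.coe_ne_top hle').comp_of_map hT.aemeasurable
  let L : Lp E p ν →ₗ[ℝ] Lp E p μ :=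
    { toFun := fun u => (hcomp u).toLp
      map_add' := fun u v => by
        rw [← MemLp.toLp_add, MemLp.toLp_eq_toLp_iff]
        exact ae_of_ae_map hT.aemeasurable (hac.ae_le (Lp.coeFn_add u v))
      map_smul' := fun r u => by
        rw [RingHom.id_apply, ← MemLp.toLp_const_smul, MemLp.toLp_eq_toLp_iff]
        exact ae_of_ae_map hT.aemeasurable (hac.ae_le (Lp.coeFn_smul r u)) }
  refine ⟨L.mkContinuous ((c : ENNReal) ^ (1 / p).toReal).toReal fun u => ?_,
    fun u => (hcomp u).coeFn_toLp⟩
  have hfinite : (c : ENNReal) ^ (1 / p).toReal ≠ ⊤ := by finiteness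
  change ‖(hcomp u).toLp‖ ≤ _
  rw [Lp.norm_toLp, Lp.norm_def, ← ENNReal.toReal_mul]
  refine ENNReal.toReal_mono (ENNReal.mul_ne_top hfinite (Lp.eLpNorm_ne_top u)) ?_
  rw [← eLpNorm_map_measure (((Lp.memLp u).1).mono_ac hac) hT.aemeasurable]
  exact eLpNorm_le_of_measure_le_smul hle'

lemma exists_continuousLinearMap_eq_integral_mul_comp {α β : Type*} [MeasurableSpace α]
    [MeasurableSpace β] {μ : Measure α} {ν : Measure β} {T : α → β} (hT : Measurable T)
    {c : NNReal} (hle : μ.map T ≤ c • ν) {G : α → ℝ} (hG : MemLp G 2 μ) :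
    ∃ L : Lp ℝ 2 ν →L[ℝ] ℝ, ∀ u, L u = ∫ y, G y * u (T y) ∂μ := by
  obtain ⟨P, hP⟩ := exists_continuousLinearMap_comp (E := ℝ) (p := 2) hT hle
  refine ⟨innerSL ℝ hG.toLp ∘L P, fun u => ?_⟩
  rw [ContinuousLinearMap.comp_apply, innerSL_apply_apply, L2.inner_def]
  refine integral_congr_ae ?_
  filter_upwards [hG.coeFn_toLp, hP u] with y hGy hPy
  rw [hGy, hPy, Real.inner_apply, Function.comp_apply]

end MeasureDomination

section SobolevToNative

lemma volume_restrict_le_smul_coordMeasure (θ : ℝ) {γ : ℝ} (hγ : 0 < γ) :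
    volume.restrict (Set.Ioo 0 1) ≤ γ.toNNReal⁻¹ • coordMeasure θ γ := by
  rw [coordMeasure, smul_add, inv_smul_smul₀ (Real.toNNReal_pos.2 hγ).ne']
  exact Measure.le_add_left le_rfl

lemma dirac_zero_le_smul_coordMeasure {θ : ℝ} (hθ : 0 < θ) (γ : ℝ) :
    Measure.dirac 0 ≤ θ.toNNReal⁻¹ • coordMeasure θ γ := by
  rw [coordMeasure, smul_add, inv_smul_smul₀ (Real.toNNReal_pos.2 hθ).ne']
  exact Measure.le_add_right le_rfl

variable {d : ℕ} {θ γ : Fin d → ℝ}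

/-- Freezing the coordinates outside `A` at `0` maps the cube to the face on which the atoms of the
other coordinate measures live. -/
lemma exists_map_piecewise_le_smul_fieldMeasure (hθ : ∀ j, 0 < θ j) (hγ : ∀ j, 0 < γ j)
    (A : Finset (Fin d)) : ∃ c : NNReal,
      (volume.restrict (unitCube d)).map (fun y => A.piecewise y 0) ≤ c • fieldMeasure θ γ := by
  set T : Fin d → ℝ → ℝ := A.piecewise (fun _ => id) 0
  have hTmeas : ∀ j, Measurable (T j) :=
    forall_piecewise A (fun _ => measurable_id) fun _ => measurable_const
  have hpiecewise (y : Fin d → ℝ) : A.piecewise y 0 = fun j => T j (y j) := by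
    ext j
    by_cases hj : j ∈ A <;> simp [T, hj]
  have (j : Fin d) := Measure.isProbabilityMeasure_map
    (μ := volume.restrict (Set.Ioo 0 1)) (hTmeas j).aemeasurable
  simp only [hpiecewise]
  rw [volume_restrict_unitCube, Measure.pi_map_pi fun j => (hTmeas j).aemeasurable]
  refine ⟨_, pi_le_prod_smul_pi
    (c := A.piecewise (fun j => (γ j).toNNReal⁻¹) fun j => (θ j).toNNReal⁻¹) fun j => ?_⟩
  by_cases hj : j ∈ A
  · simpa [T, hj] using volume_restrict_le_smul_coordMeasure (θ j) (hγ j)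
  · simpa [T, hj, Pi.zero_def] using dirac_zero_le_smul_coordMeasure (hθ j) (γ j)

namespace MemNativeSpace

lemma congr {f g : (Fin d → ℝ) → ℝ} (hf : MemNativeSpace θ γ f)
    (hfg : Set.EqOn g f (unitCube d)) : MemNativeSpace θ γ g := by
  obtain ⟨L, hL⟩ := hf
  exact ⟨L, fun z hz => (hfg hz).trans (hL z hz)⟩

lemma sum {κ : Type*} {s : Finset κ} {f : κ → (Fin d → ℝ) → ℝ}
    (hf : ∀ i ∈ s, MemNativeSpace θ γ (f i)) : MemNativeSpace θ γ fun x => ∑ i ∈ s, f i x := by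
  choose! L hL using hf
  refine ⟨∑ i ∈ s, L i, fun z hz => ?_⟩
  rw [_root_.sum_apply]
  exact Finset.sum_congr rfl fun i hi => hL i hi z hz

lemma const_mul {f : (Fin d → ℝ) → ℝ} (hf : MemNativeSpace θ γ f) (r : ℝ) :
    MemNativeSpace θ γ fun x => r * f x := by
  obtain ⟨L, hL⟩ := hf
  exact ⟨r • L, fun z hz => congrArg (r * ·) (hL z hz)⟩

end MemNativeSpace

lemma memNativeSpace_integral_mul_prod_indicator (hθ : ∀ j, 0 < θ j) (hγ : ∀ j, 0 < γ j)
    {G : (Fin d → ℝ) → ℝ} (hG : MemLp G 2 (volume.restrict (unitCube d))) (A : Finset (Fin d)) :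
    MemNativeSpace θ γ fun x => ∫ y in unitCube d, G y *
      ∏ j, A.piecewise (fun j => (Set.Iic (x j)).indicator 1) 1 j (y j) := by
  obtain ⟨c, hc⟩ := exists_map_piecewise_le_smul_fieldMeasure hθ hγ A
  have hT : Measurable fun y : Fin d → ℝ => A.piecewise y 0 := measurable_pi_iff.2 fun j => by
    by_cases hj : j ∈ A <;> simp only [hj, Finset.piecewise_eq_of_mem, not_false_eq_true,
      Finset.piecewise_eq_of_notMem, Pi.zero_apply]
    exacts [measurable_pi_apply j, measurable_const]
  obtain ⟨L, hL⟩ := exists_continuousLinearMap_eq_integral_mul_comp hT hc hG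
  refine ⟨L, fun z hz => ?_⟩
  have hac := Measure.absolutelyContinuous_of_le_smul (c := (c : ENNReal)) hc
  rw [hL]
  refine integral_congr_ae ?_
  filter_upwards [ae_of_ae_map hT.aemeasurable (hac.ae_le (coeFn_lowerIndicator _ z))] with y hy
  have hcoord (j : Fin d) : A.piecewise (fun j => (Set.Iic (z j)).indicator 1) 1 j (y j) =
      if A.piecewise y 0 j ≤ z j then (1 : ℝ) else 0 := by
    by_cases hj : j ∈ A <;> simp [hj, Set.indicator_apply, (hz j).1.le]
  rw [hy]
  by_cases hyz : A.piecewise y 0 ≤ z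
  · simp [hcoord, hyz, Pi.le_def.1 hyz]
  · simp [hcoord, hyz, Finset.prod_ite_zero, mt Pi.le_def.2 hyz]

lemma memNativeSpace_integral_mul_prod (hθ : ∀ j, 0 < θ j) (hγ : ∀ j, 0 < γ j)
    {G : (Fin d → ℝ) → ℝ} (hG : MemLp G 2 (volume.restrict (unitCube d))) {u v : Fin d → ℝ → ℝ}
    (hu : ∀ j, Measurable (u j)) (hv : ∀ j, Measurable (v j))
    (hubdd : ∀ j, ∃ B, ∀ t, |u j t| ≤ B) (hvbdd : ∀ j, ∃ B, ∀ t, |v j t| ≤ B) :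
    MemNativeSpace θ γ fun x => ∫ y in unitCube d, G y *
      ∏ j, (u j (y j) * (Set.Iic (x j)).indicator 1 (y j) + v j (y j)) := by
  have hGA (A : Finset (Fin d)) :
      MemLp (fun y => G y * ∏ j, A.piecewise u v j (y j)) 2 (volume.restrict (unitCube d)) :=
    memLp_mul_prod_eval hG (forall_piecewise A hu hv)
      (forall_piecewise (P := fun u : ℝ → ℝ => ∃ B, ∀ t, |u t| ≤ B) A hubdd hvbdd)
  refine (MemNativeSpace.sum (s := Finset.univ) fun A _ =>
    memNativeSpace_integral_mul_prod_indicator hθ hγ (hGA A) A).congr fun x _ => ?_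
  have hind (A : Finset (Fin d)) : ∀ j,
      Measurable (A.piecewise (fun j => (Set.Iic (x j)).indicator (1 : ℝ → ℝ)) 1 j) :=
    forall_piecewise A (fun _ => measurable_one.indicator measurableSet_Iic) fun _ => measurable_one
  have hindbdd (A : Finset (Fin d)) : ∀ j, ∃ B, ∀ t,
      |A.piecewise (fun j => (Set.Iic (x j)).indicator (1 : ℝ → ℝ)) 1 j t| ≤ B :=
    forall_piecewise (P := fun u : ℝ → ℝ => ∃ B, ∀ t, |u t| ≤ B) A
      (fun j => ⟨1, fun t => by by_cases ht : t ≤ x j <;> simp [ht]⟩) fun _ => ⟨1, by simp⟩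
  beta_reduce
  rw [← integral_finsetSum _ fun A _ =>
    integrable_mul_prod_eval ((hGA A).integrable one_le_two) (hind A) (hindbdd A)]
  congr! 2
  rw [prod_add_eval_eq_sum_piecewise (fun j t => u j t * (Set.Iic (x j)).indicator 1 t) v,
    Finset.mul_sum]
  refine Finset.sum_congr rfl fun A _ => ?_
  rw [mul_assoc, ← Finset.prod_mul_distrib]
  refine congrArg _ (Finset.prod_congr rfl fun j _ => ?_)
  by_cases hj : j ∈ A <;> simp [hj]

theorem MemHMixOne.memNativeSpace (hθ : ∀ j, 0 < θ j) (hγ : ∀ j, 0 < γ j)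
    {f : (Fin d → ℝ) → ℝ} (hf : MemHMixOne f) (hcont : ContinuousOn f (unitCube d)) :
    MemNativeSpace θ γ f := by
  choose g hgL2 hg using hf.2
  obtain ⟨w, hw⟩ := exists_isMollifier (show (1 / 4 : ℝ) < 3 / 4 by norm_num)
  refine (MemNativeSpace.sum (s := Finset.univ) fun S _ => (memNativeSpace_integral_mul_prod
    hθ hγ (hgL2 S) (u := S.piecewise (fun _ _ => -1) fun _ _ => 0)
    (v := S.piecewise (fun _ => 1 - primitive w) fun _ => w) ?_ ?_ ?_ ?_).const_mul
    ((-1) ^ S.card)).congr fun x hx => ?_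
  · exact forall_piecewise S (fun _ => measurable_const) fun _ => measurable_const
  · exact forall_piecewise S
      (fun _ => (contDiff_const.sub hw.contDiff_primitive).continuous.measurable)
      fun _ => hw.contDiff.continuous.measurable
  · exact forall_piecewise (P := fun u : ℝ → ℝ => ∃ B, ∀ t, |u t| ≤ B) S
      (fun _ => ⟨1, by simp⟩) fun _ => ⟨0, by simp⟩
  · exact forall_piecewise (P := fun u : ℝ → ℝ => ∃ B, ∀ t, |u t| ≤ B) S
      (fun _ => ⟨1, fun t => Real.dist_le_of_mem_Icc_01 unitInterval.one_mem
        (hw.primitive_mem_Icc t)⟩)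
      fun _ => hw.exists_abs_le
  · rw [eq_sum_integral_weakMixedPartial (hf.1.integrable one_le_two) hg
      (fun S => (hgL2 S).integrable one_le_two) (by norm_num) (by norm_num) hw hx (hcont x hx)]
    congr! 6 with S _ y j
    by_cases hj : j ∈ S <;> simp [hj]
    ring

end SobolevToNative

theorem mainTheorem1_general {d : ℕ} (hd : 1 ≤ d)
    (θ γ : Fin d → ℝ) (hθ : ∀ j, 0 < θ j) (hγ : ∀ j, 0 < γ j)
    (f : (Fin d → ℝ) → ℝ) (hf : MemHMixOne f) (hcont : ContinuousOn f (unitCube d)) :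
    ∃ C : ℝ, ∀ N : ℕ, 2 ≤ N → ∀ (τ : ℕ) (x : ℕ → Fin d → ℝ),
      IsKEIBSRun θ γ 0 0 (fun _ => 1) N τ x (fun i => f (x i)) →
      ∀ ε : ℝ, ∀ xhat ∈ unitCube d,
        (∀ z ∈ unitCube d,
          surrogateMean θ γ 0 0 (fun _ => 1) (sparseGrid d τ).card x (fun i => f (x i)) N z ≤
            surrogateMean θ γ 0 0 (fun _ => 1) (sparseGrid d τ).card x (fun i => f (x i)) N xhat
              + ε) →
        ∀ z ∈ unitCube d, f z - f xhat ≤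
          C * ((N : ℝ) ^ (-(1 / 2) : ℝ) * Real.log N ^ (3 * ((d : ℝ) - 1) / 2)) + ε := by
  obtain ⟨e, rfl⟩ := Nat.exists_eq_add_of_le' hd
  obtain ⟨C, hC⟩ := (hf.memNativeSpace hθ hγ hcont).exists_abs_sub_surrogateMean_le
    (fun j => (hθ j).le) hγ
  refine ⟨2 * C, fun N hN τ x hrun ε xhat hxhat hopt z hz => ?_⟩
  have herror_z := (abs_le.1 (hC N hN τ x hrun z hz)).2
  have herror_xhat := (abs_le.1 (hC N hN τ x hrun xhat hxhat)).1
  rw [Nat.cast_add_one, add_sub_cancel_right]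
  linarith [hopt z hz]

theorem mainTheorem1 {d : ℕ} (hd : 1 ≤ d)
    (θ γ : Fin d → ℝ) (hθ : ∀ j, 0 < θ j) (hγ : ∀ j, 0 < γ j)
    (f : (Fin d → ℝ) → ℝ) (hf : MemHMixOne f) (hcont : ContinuousOn f (unitCube d))
    (xstar : Fin d → ℝ) (hxstar : xstar ∈ unitCube d) (hmax : IsMaxOn f (unitCube d) xstar) :
    ∃ C : ℝ, ∀ N : ℕ, 2 ≤ N → ∀ (τ : ℕ) (x : ℕ → Fin d → ℝ),
      IsKEIBSRun θ γ 0 0 (fun _ => 1) N τ x (fun i => f (x i)) →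
      ∀ ε : ℝ, 0 ≤ ε → ∀ xhat ∈ unitCube d,
        (∀ z ∈ unitCube d,
          surrogateMean θ γ 0 0 (fun _ => 1) (sparseGrid d τ).card x (fun i => f (x i)) N z ≤
            surrogateMean θ γ 0 0 (fun _ => 1) (sparseGrid d τ).card x (fun i => f (x i)) N xhat
              + ε) →
        f xstar - f xhat ≤
          C * ((N : ℝ) ^ (-(1 / 2) : ℝ) * Real.log N ^ (3 * ((d : ℝ) - 1) / 2)) + ε := by
  obtain ⟨C, hC⟩ := mainTheorem1_general hd θ γ hθ hγ f hf hcont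
  exact ⟨C, fun N hN τ x hrun ε _ xhat hxhat hopt =>
    hC N hN τ x hrun ε xhat hxhat hopt xstar hxstar⟩
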